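/- Let $m\ge 0$ be an integer, let $\lambda>m/2$ be real, let $\mu_1,\dots,\mu_m>0$ and $\mu_0=1$, and put $2\lambda_j=2\lambda-m+2j$ for $0\le j\le m$. For $\nu>0$ let $A^{(\nu)}(\mathbb D)$ be the Hilbert space of holomorphic functions on the open unit disc $\mathbb D$ with reproducing kernel $(1-z\bar\omega)^{-2\nu}$; equivalently, the functions $\sqrt{(2\nu)_n/n!}\,z^n$, $n\ge 0$, form an orthonormal basis, where $(x)_n=x(x+1)\cdots(x+n-1)$. For $f\in A^{(\lambda_j)}(\mathbb D)$ let $\Gamma_jf:\mathbb D\to\mathbb C^{m+1}$ be the function with components, for $0\le \ell\le m$, $$(\Gamma_jf)_\ell=\binom{\ell}{j}\frac{1}{(2\lambda_j)_{\ell-j}}\,f^{(\ell-j)}\ \text{ if } \ell\ge j,\qquad (\Gamma_jf)_\ell=0\ \text{ if } \ell<j.$$ The map $(f_0,\dots,f_m)\mapsto\sum_{j=0}^m\mu_j\Gamma_jf_j$ on $\bigoplus_{j=0}^m A^{(\lambda_j)}(\mathbb D)$ is injective. Let $\mathbf A^{(\lambda,\mu)}(\mathbb D)$ be its image, with the Hilbert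 space structure that makes this map unitary from the orthogonal direct sum. It is a reproducing kernel Hilbert space of $\mathbb C^{m+1}$-valued holomorphic functions on $\mathbb D$, with kernel $\sum_j\mu_j^2\mathbf B^{(\lambda_j)}$, where $\mathbf B^{(\lambda_j)}$ is the kernel of the image of $\Gamma_j$ with the inner product transferred from $A^{(\lambda_j)}(\mathbb D)$. Then the multiplication operator $M^{(\lambda,\mu)}$, $(M^{(\lambda,\mu)}f)(z)=zf(z)$, is a well-defined bounded operator on $\mathbf A^{(\lambda,\mu)}(\mathbb D)$, and it is irreducible: if $N$ is a closed subspace such that $N$ and $N^\perp$ are both invariant under $M^{(\lambda,\mu)}$, then $N=\{0\}$ or $N=\mathbf A^{(\lambda,\mu)}(\mathbb D)$. -/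

import Mathlib

noncomputable section

open scoped ComplexConjugate Complex.UnitDisc InnerProductSpace

namespace KoranyiMisra

/-- `√((2λ)ₙ / n!)`, where `(x)ₙ` is the rising Pochhammer symbol. -/
def weight (lam : ℝ) (n : ℕ) : ℝ :=
  √((ascPochhammer ℝ n).eval (2 * lam) / (n.factorial : ℝ))

theorem weight_sq {lam : ℝ} (h : 0 < lam) (n : ℕ) :
    weight lam n ^ 2 = (ascPochhammer ℝ n).eval (2 * lam) / (n.factorial : ℝ) :=
  Real.sq_sqrt (div_nonneg (ascPochhammer_pos n _ (by positivity)).le (by positivity))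

theorem weight_pos {lam : ℝ} (h : 0 < lam) (n : ℕ) : 0 < weight lam n :=
  Real.sqrt_pos.2 (div_pos (ascPochhammer_pos n _ (by positivity)) (by positivity))

theorem hasSum_weight {lam : ℝ} (h : 0 < lam) {z : ℂ} (hz : ‖z‖ < 1) :
    HasSum (fun n => (weight lam n : ℂ) ^ 2 * z ^ n) ((1 - z) ^ (-(2 * lam : ℝ) : ℂ)) := by
  have h1 := (Complex.one_div_one_sub_cpow_hasFPowerSeriesOnBall_zero
    ((2 * lam : ℝ) : ℂ)).hasSum (y := z)
      (by simpa [Metric.mem_eball, edist_zero_right, ← ofReal_norm] using hz)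
  rw [zero_add] at h1
  rw [Complex.cpow_neg, ← one_div]
  refine h1.congr_fun fun n => ?_
  rw [FormalMultilinearSeries.ofScalars_apply_eq, smul_eq_mul]
  congr 1
  have h2 := Ring.factorial_nsmul_multichoose_eq_ascPochhammer ((2 * lam : ℝ) : ℂ) n
  rw [Polynomial.ascPochhammer_smeval_eq_eval, nsmul_eq_mul] at h2
  have h3 : (n.factorial : ℂ) ≠ 0 := by exact_mod_cast n.factorial_ne_zero
  rw [← Complex.ofReal_pow, weight_sq h, Ring.choose,
    show ((2 * lam : ℝ) : ℂ) + n - 1 - n + 1 = ((2 * lam : ℝ) : ℂ) by ring,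
    Complex.ofReal_div, Complex.ofReal_natCast, div_eq_iff h3,
    mul_comm (Ring.multichoose _ _), h2]
  have := Polynomial.eval₂_at_apply (p := ascPochhammer ℝ n) Complex.ofRealHom (2 * lam)
  rw [Polynomial.eval₂_eq_eval_map, ascPochhammer_map] at this
  exact this.symm

/-- The Hilbert space `A^{(λ)}(𝔻)`, `λ > 0`: an element is a holomorphic function
`f = ∑ₙ aₙ √((2λ)ₙ / n!) zⁿ` with `(aₙ)` square summable, and the inner product is the one
for which the functions `√((2λ)ₙ / n!) zⁿ` form an orthonormal basis. -/
def Berg (lam : ℝ) (_ : 0 < lam) : Type := lp (fun _ : ℕ => ℂ) 2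

namespace Berg

variable {lam : ℝ} {h : 0 < lam}

instance : NormedAddCommGroup (Berg lam h) :=
  inferInstanceAs (NormedAddCommGroup (lp (fun _ : ℕ => ℂ) 2))

instance : InnerProductSpace ℂ (Berg lam h) :=
  inferInstanceAs (InnerProductSpace ℂ (lp (fun _ : ℕ => ℂ) 2))

instance : CompleteSpace (Berg lam h) :=
  inferInstanceAs (CompleteSpace (lp (fun _ : ℕ => ℂ) 2))

/-- The coordinates of `f` in the orthonormal basis `√((2λ)ₙ / n!) zⁿ`. -/
def coord (f : Berg lam h) (n : ℕ) : ℂ := (show lp (fun _ : ℕ => ℂ) 2 from f) n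

/-- The function `f` on the open unit disc. -/
def fn (f : Berg lam h) (z : ℂ) : ℂ := ∑' n, (weight lam n : ℂ) * coord f n * z ^ n

theorem memlp_ker {z : ℂ} (h : 0 < lam) (hz : ‖z‖ < 1) :
    Memℓp (fun n => (weight lam n : ℂ) * conj z ^ n) 2 := by
  have h1 := (hasSum_weight h (z := z * conj z)
    (by simp only [norm_mul, RCLike.norm_conj]; nlinarith [norm_nonneg z])).summable.norm
  refine memℓp_gen (h1.congr fun n => ?_)
  simp [mul_pow, ← pow_mul, mul_comm]
  ring

/-- The kernel vector at `z`. -/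
def ker (h : 0 < lam) {z : ℂ} (hz : ‖z‖ < 1) : Berg lam h :=
  show lp (fun _ : ℕ => ℂ) 2 from ⟨_, memlp_ker h hz⟩

theorem hasSum_fn (f : Berg lam h) {z : ℂ} (hz : ‖z‖ < 1) :
    HasSum (fun n => (weight lam n : ℂ) * coord f n * z ^ n) ⟪ker h hz, f⟫_ℂ := by
  refine (lp.hasSum_inner (𝕜 := ℂ) (show lp (fun _ : ℕ => ℂ) 2 from ker h hz)
    (show lp (fun _ : ℕ => ℂ) 2 from f)).congr_fun fun n => ?_
  change _ = (coord f n) * conj ((weight lam n : ℂ) * conj z ^ n)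
  simp
  ring

theorem fn_eq_inner (f : Berg lam h) {z : ℂ} (hz : ‖z‖ < 1) : fn f z = ⟪ker h hz, f⟫_ℂ :=
  (hasSum_fn f hz).tsum_eq

theorem norm_ker_le {z : ℂ} {r : ℝ} (hz : ‖z‖ ≤ r) (hr : r < 1) :
    ‖ker h (hz.trans_lt hr)‖ ≤
      ‖ker h (z := (r : ℂ)) (by simpa [abs_of_nonneg ((norm_nonneg z).trans hz)] using hr)‖ := by
  have hr0 := (norm_nonneg z).trans hz
  refine lp.norm_mono (p := 2) (by norm_num) (x := (show lp (fun _ : ℕ => ℂ) 2 from ker h _))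
    (y := (show lp (fun _ : ℕ => ℂ) 2 from ker h _)) fun n => ?_
  change ‖(weight lam n : ℂ) * conj z ^ n‖ ≤ ‖(weight lam n : ℂ) * conj (r : ℂ) ^ n‖
  simp only [norm_mul, norm_pow, RCLike.norm_conj, Complex.norm_real, Real.norm_eq_abs,
    abs_of_nonneg hr0]
  gcongr

theorem differentiableOn_fn (f : Berg lam h) :
    DifferentiableOn ℂ (fn f) (Metric.ball 0 1) := by
  intro z hz
  rw [mem_ball_zero_iff] at hz
  obtain ⟨r, hzr, hr⟩ := exists_between hz
  have hr0 := (norm_nonneg z).trans hzr.le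
  have h1 := (hasSum_fn f (z := (r : ℂ)) (by simpa [abs_of_nonneg hr0] using hr)).summable.norm
  have h2 := Complex.differentiableOn_tsum_of_summable_norm (U := Metric.ball (0 : ℂ) r)
    (F := fun n (w : ℂ) => (weight lam n : ℂ) * coord f n * w ^ n) h1
    (fun n => by fun_prop) Metric.isOpen_ball (fun n w hw => by
      rw [mem_ball_zero_iff] at hw
      simp only [norm_mul, norm_pow, Complex.norm_real, Real.norm_eq_abs, abs_of_nonneg hr0]
      gcongr)
  exact (h2.differentiableAt
    (Metric.isOpen_ball.mem_nhds (by simpa using hzr))).differentiableWithinAt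

theorem exists_bound (lam : ℝ) (h : 0 < lam) (k : ℕ) {z : ℂ} (hz : ‖z‖ < 1) :
    ∃ C : ℝ, ∀ f : Berg lam h, ‖iteratedDeriv k (fn f) z‖ ≤ C * ‖f‖ := by
  obtain ⟨r, hzr, hr⟩ := exists_between hz
  have hr0 := (norm_nonneg z).trans hzr.le
  have hr' : ‖(r : ℂ)‖ < 1 := by simpa [abs_of_nonneg hr0] using hr
  have hsub : ∀ w ∈ Metric.closedBall z (r - ‖z‖), ‖w‖ ≤ r := fun w hw => by
    rw [mem_closedBall_iff_norm] at hw
    linarith [norm_le_norm_add_norm_sub' w z]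
  refine ⟨k.factorial * ‖ker h hr'‖ / (r - ‖z‖) ^ k, fun f => ?_⟩
  refine (Complex.norm_iteratedDeriv_le_of_forall_mem_sphere_norm_le k (sub_pos.2 hzr)
    (C := ‖ker h hr'‖ * ‖f‖) ?_ fun w hw => ?_).trans_eq (by ring)
  · refine DifferentiableOn.diffContOnCl_ball (U := Metric.ball 0 1) (differentiableOn_fn f) ?_
    exact fun w hw => by simpa using (hsub w hw).trans_lt hr
  · have hw' := hsub w (Metric.sphere_subset_closedBall hw)
    rw [fn_eq_inner f (hw'.trans_lt hr)]
    exact (norm_inner_le_norm _ _).trans (by gcongr; exact norm_ker_le hw' hr)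

theorem fn_add (f g : Berg lam h) {z : ℂ} (hz : ‖z‖ < 1) : fn (f + g) z = fn f z + fn g z := by
  simp [fn_eq_inner _ hz]

theorem fn_smul (c : ℂ) (f : Berg lam h) {z : ℂ} (hz : ‖z‖ < 1) :
    fn (c • f) z = c * fn f z := by
  simp [fn_eq_inner _ hz]

theorem contDiffAt_fn (f : Berg lam h) (k : ℕ) {z : ℂ} (hz : ‖z‖ < 1) :
    ContDiffAt ℂ k (fn f) z :=
  ((differentiableOn_fn f).contDiffOn Metric.isOpen_ball).contDiffAt
    (Metric.isOpen_ball.mem_nhds (by simpa using hz))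

/-- The functional `f ↦ f⁽ᵏ⁾(z)`, for `z` in the open unit disc. -/
def derivCLM (lam : ℝ) (h : 0 < lam) (k : ℕ) (z : 𝔻) : Berg lam h →L[ℂ] ℂ :=
  LinearMap.mkContinuousOfExistsBound
    { toFun := fun f => iteratedDeriv k (fn f) z
      map_add' := fun f g => by
        rw [← iteratedDeriv_fun_add (contDiffAt_fn f k z.norm_lt_one)
          (contDiffAt_fn g k z.norm_lt_one)]
        refine Filter.EventuallyEq.iteratedDeriv_eq k ?_
        filter_upwards [Metric.isOpen_ball.mem_nhds (mem_ball_zero_iff.2 z.norm_lt_one)] with w hw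
        exact fn_add f g (mem_ball_zero_iff.1 hw)
      map_smul' := fun c f => by
        rw [RingHom.id_apply, smul_eq_mul,
          ← iteratedDeriv_const_mul c (contDiffAt_fn f k z.norm_lt_one)]
        refine Filter.EventuallyEq.iteratedDeriv_eq k ?_
        filter_upwards [Metric.isOpen_ball.mem_nhds (mem_ball_zero_iff.2 z.norm_lt_one)] with w hw
        exact fn_smul c f (mem_ball_zero_iff.1 hw) }
    (exists_bound lam h k z.norm_lt_one)

@[simp]
theorem derivCLM_apply (k : ℕ) (z : 𝔻) (f : Berg lam h) :
    derivCLM lam h k z f = iteratedDeriv k (fn f) z := rfl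

theorem eq_zero_of_fn (f : Berg lam h) (hf : ∀ z : 𝔻, fn f z = 0) : f = 0 := by
  have hball : ∀ {y : ℂ}, y ∈ Metric.eball (0 : ℂ) (2⁻¹ : NNReal) → ‖y‖ < 1 := fun {y} hy => by
    rw [Metric.eball_coe, mem_ball_zero_iff] at hy
    refine hy.trans ?_
    norm_num
  have hp : HasFPowerSeriesOnBall (fn f) (FormalMultilinearSeries.ofScalars ℂ
      fun n => (weight lam n : ℂ) * coord f n) 0 (2⁻¹ : NNReal) :=
    { r_le := by
        refine FormalMultilinearSeries.le_radius_of_summable_norm _ ?_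
        refine (hasSum_fn f (z := (2⁻¹ : ℂ)) (by norm_num)).summable.norm.congr fun n => ?_
        simp
      r_pos := by simp
      hasSum := fun {y} hy => by
        have := hasSum_fn f (hball hy)
        rw [← fn_eq_inner] at this
        rw [zero_add]
        refine this.congr_fun fun n => ?_
        rw [FormalMultilinearSeries.ofScalars_apply_eq, smul_eq_mul] }
  have h0 := (hp.congr (g := 0) fun y hy => hf ⟨y, by simpa using hball hy⟩).hasFPowerSeriesAt
  have h1 := h0.eq_zero
  refine lp.ext (E := fun _ : ℕ => ℂ) (p := 2) (funext fun n => ?_)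
  have h2 := congrArg (fun q => q.coeff n) h1
  simp only [FormalMultilinearSeries.coeff_ofScalars] at h2
  have h3 : (weight lam n : ℂ) ≠ 0 := by exact_mod_cast (weight_pos h n).ne'
  exact (mul_eq_zero.1 h2).resolve_left h3

/-- `A^{(λ)}(𝔻)` as a reproducing kernel Hilbert space of functions on the unit disc. -/
instance : RKHS ℂ (Berg lam h) 𝔻 ℂ where
  coeCLM := .pi fun z => derivCLM lam h 0 z
  coeCLM_injective := (injective_iff_map_eq_zero _).2 fun f hf =>
    eq_zero_of_fn f fun z => by simpa using congrFun hf z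

theorem coe_eq_fn (f : Berg lam h) (z : 𝔻) : f z = fn f z := by
  change iteratedDeriv 0 (fn f) z = _
  simp

/-- The reproducing kernel of `A^{(λ)}(𝔻)` is `(1 - z ω̄)^{-2λ}`. -/
theorem kernel_apply (z w : 𝔻) (v : ℂ) :
    RKHS.kernel (Berg lam h) z w v = (1 - (z : ℂ) * conj (w : ℂ)) ^ (-(2 * lam : ℝ) : ℂ) * v := by
  have h1 : RKHS.kerFun (Berg lam h) w v = v • ker h w.norm_lt_one := by
    refine ext_inner_right ℂ fun f => ?_
    rw [RKHS.kerFun_inner, coe_eq_fn, inner_smul_left, fn_eq_inner f w.norm_lt_one]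
    simp [mul_comm]
  rw [← RKHS.kerFun_apply, h1, coe_eq_fn, fn_smul _ _ z.norm_lt_one, mul_comm]
  congr 1
  have h2 : ‖(z : ℂ) * conj (w : ℂ)‖ < 1 := by
    rw [norm_mul, RCLike.norm_conj]
    nlinarith [norm_nonneg (z : ℂ), norm_nonneg (w : ℂ), z.norm_lt_one, w.norm_lt_one]
  rw [← (hasSum_weight h h2).tsum_eq]
  refine tsum_congr fun n => ?_
  change (weight lam n : ℂ) * ((weight lam n : ℂ) * conj (w : ℂ) ^ n) * (z : ℂ) ^ n = _
  ring

end Berg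

/-- `λ_j`, given by `2λ_j = 2λ - m + 2j`. -/
def lamj (m : ℕ) (lam : ℝ) (j : Fin (m + 1)) : ℝ := lam - m / 2 + (j : ℕ)

theorem lamj_pos {m : ℕ} {lam : ℝ} (hlam : (m : ℝ) / 2 < lam) (j : Fin (m + 1)) :
    0 < lamj m lam j := by
  have : (0 : ℝ) ≤ (j : ℕ) := by positivity
  unfold lamj
  linarith

/-- The map `f ↦ (Γ_j f)(z)`, `A^{(λ_j)}(𝔻) → ℂ^{m+1}`, for `z ∈ 𝔻`. -/
def Gam {m : ℕ} {lam : ℝ} (hlam : (m : ℝ) / 2 < lam) (j : Fin (m + 1)) (z : 𝔻) :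
    Berg (lamj m lam j) (lamj_pos hlam j) →L[ℂ] EuclideanSpace ℂ (Fin (m + 1)) :=
  (EuclideanSpace.equiv (Fin (m + 1)) ℂ).symm.toContinuousLinearMap ∘L
    .pi fun l : Fin (m + 1) =>
      if j ≤ l then
        (((l : ℕ).choose j : ℂ) /
            (((ascPochhammer ℝ ((l : ℕ) - j)).eval (2 * lamj m lam j) : ℝ) : ℂ)) •
          Berg.derivCLM (lamj m lam j) (lamj_pos hlam j) ((l : ℕ) - j) z
      else 0

theorem Gam_apply {m : ℕ} {lam : ℝ} (hlam : (m : ℝ) / 2 < lam) (j : Fin (m + 1)) (z : 𝔻)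
    (f : Berg (lamj m lam j) (lamj_pos hlam j)) (l : Fin (m + 1)) :
    Gam hlam j z f l =
      if j ≤ l then
        ((l : ℕ).choose j : ℂ) /
            (((ascPochhammer ℝ ((l : ℕ) - j)).eval (2 * lamj m lam j) : ℝ) : ℂ) *
          iteratedDeriv ((l : ℕ) - j) f.fn z
      else 0 := by
  simp only [Gam]
  split_ifs with hjl <;> simp [hjl]

/-- The Hilbert space `A^{(λ,μ)}(𝔻)`: its elements are the functions `∑_j μ_j Γ_j f_j` with
`f_j ∈ A^{(λ_j)}(𝔻)`, and its inner product is the one for which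
`(f_j)_j ↦ ∑_j μ_j Γ_j f_j` is unitary from the Hilbert space direct sum of the `A^{(λ_j)}(𝔻)`. -/
def ASpace (m : ℕ) (lam : ℝ) (mu : Fin (m + 1) → ℝ) (hlam : (m : ℝ) / 2 < lam)
    (_ : ∀ j, 0 < mu j) : Type :=
  PiLp 2 fun j : Fin (m + 1) => Berg (lamj m lam j) (lamj_pos hlam j)

namespace ASpace

variable {m : ℕ} {lam : ℝ} {mu : Fin (m + 1) → ℝ} {hlam : (m : ℝ) / 2 < lam}
  {hmu : ∀ j, 0 < mu j}

instance : NormedAddCommGroup (ASpace m lam mu hlam hmu) :=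
  inferInstanceAs (NormedAddCommGroup
    (PiLp 2 fun j : Fin (m + 1) => Berg (lamj m lam j) (lamj_pos hlam j)))

instance : InnerProductSpace ℂ (ASpace m lam mu hlam hmu) :=
  inferInstanceAs (InnerProductSpace ℂ
    (PiLp 2 fun j : Fin (m + 1) => Berg (lamj m lam j) (lamj_pos hlam j)))

instance : CompleteSpace (ASpace m lam mu hlam hmu) :=
  inferInstanceAs (CompleteSpace
    (PiLp 2 fun j : Fin (m + 1) => Berg (lamj m lam j) (lamj_pos hlam j)))

/-- The component `f_j` of `∑_j μ_j Γ_j f_j`. -/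
def comp (j : Fin (m + 1)) :
    ASpace m lam mu hlam hmu →L[ℂ] Berg (lamj m lam j) (lamj_pos hlam j) :=
  PiLp.proj 2 (fun j : Fin (m + 1) => Berg (lamj m lam j) (lamj_pos hlam j)) j

/-- The value at `z` of the function `∑_j μ_j Γ_j f_j`. -/
def eval (z : 𝔻) : ASpace m lam mu hlam hmu →L[ℂ] EuclideanSpace ℂ (Fin (m + 1)) :=
  ∑ j, (mu j : ℂ) • (Gam hlam j z ∘L comp j)

theorem eq_zero_of_eval (f : ASpace m lam mu hlam hmu) (hf : ∀ z, eval z f = 0) : f = 0 := by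
  have key : ∀ (n : ℕ) (l : Fin (m + 1)), (l : ℕ) = n → comp l f = 0 := by
    intro n
    induction n using Nat.strong_induction_on with
    | _ n ih =>
      intro l hl
      refine Berg.eq_zero_of_fn _ fun z => ?_
      have h1 := congrArg (fun v : EuclideanSpace ℂ (Fin (m + 1)) => v l) (hf z)
      simp only [eval, FunLike.coe_sum, Finset.sum_apply, FunLike.coe_smul, Pi.smul_apply,
        ContinuousLinearMap.comp_apply, WithLp.ofLp_sum, WithLp.ofLp_smul, smul_eq_mul,
        PiLp.zero_apply] at h1
      rw [Finset.sum_eq_single l] at h1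
      · rw [Gam_apply] at h1
        have h2 : (mu l : ℂ) ≠ 0 := by exact_mod_cast (hmu l).ne'
        simpa [h2] using h1
      · intro j _ hjl
        rcases lt_or_gt_of_ne hjl with hlt | hlt
        · rw [ih j (by omega) j rfl]
          simp
        · rw [Gam_apply, if_neg (not_le.2 hlt), mul_zero]
      · simp
  exact PiLp.ext fun j => key j j rfl

/-- `A^{(λ,μ)}(𝔻)` as a reproducing kernel Hilbert space of `ℂ^{m+1}`-valued functions on `𝔻`. -/
instance : RKHS ℂ (ASpace m lam mu hlam hmu) 𝔻 (EuclideanSpace ℂ (Fin (m + 1))) where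
  coeCLM := .pi eval
  coeCLM_injective := (injective_iff_map_eq_zero _).2 fun f hf =>
    eq_zero_of_eval f fun z => congrFun hf z

theorem coe_apply (f : ASpace m lam mu hlam hmu) (z : 𝔻) :
    f z = ∑ j, (mu j : ℂ) • Gam hlam j z (comp j f) := by
  change eval z f = _
  simp [eval]

end ASpace

/-- A closed subspace `N` reduces `T` if `N` and its orthogonal complement are `T`-invariant. -/
def IsReducing {H : Type*} [NormedAddCommGroup H] [InnerProductSpace ℂ H]
    (T : H →L[ℂ] H) (N : Submodule ℂ H) : Prop :=
  IsClosed (N : Set H) ∧ (∀ f ∈ N, T f ∈ N) ∧ ∀ f ∈ Nᗮ, T f ∈ Nᗮ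

/-- A bounded operator on a nonzero Hilbert space is irreducible if its only reducing subspaces
are `0` and the whole space. -/
def IsIrreducibleOp {H : Type*} [NormedAddCommGroup H] [InnerProductSpace ℂ H]
    (T : H →L[ℂ] H) : Prop :=
  Nontrivial H ∧ ∀ N : Submodule ℂ H, IsReducing T N → N = ⊥ ∨ N = ⊤

end KoranyiMisra

end

noncomputable section

open scoped ComplexConjugate Complex.UnitDisc InnerProductSpace
open Filter Topology

namespace KoranyiMisra

/-! Write x = 2λ - m. The coefficients of the Γ_j form a lower triangular matrix with an explicit
inverse (`gamInvCoeff`), so every z^p e_l lies in the space, and the orthonormal basis vectors are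
finite combinations of these monomials. Give z^p e_l degree p + l: different degrees are orthogonal
and M raises the degree by one.

M is bounded: the error z Γ_j f - Γ_j(z f) involves only lower derivatives of f and is absorbed by
the Γ_i with i > j; the closed graph theorem does the rest.

M is irreducible: powers of M* annihilate every basis vector, so a nonzero reducing subspace meets
ker M* (`IsReducing.eq_bot_of_ker_adjoint`), and ker M* consists of polynomials of degree at most m.
If N and its complement were both nonzero, they would contain nonzero polynomials f and g with M^k f
orthogonal to M^n g for all k, n. But for p + l = q + r the inner product of z^{p+n} e_l and z^{q+n}
e_r is asymptotic to C n^{1-x-l-r}, with C = `gramLimit` nonzero because all its terms have the same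
sign. Small l and r dominate, so a single pair of leading terms survives in the limit, a
contradiction (`exists_inner_pow_ne_zero`). -/

/-! ### Inverting the coefficient matrix of the Γ_j -/

theorem ascPochhammer_eval_add (a b : ℕ) (x : ℝ) :
    (ascPochhammer ℝ (a + b)).eval x =
      (ascPochhammer ℝ a).eval x * (ascPochhammer ℝ b).eval (x + a) := by
  rw [← ascPochhammer_mul, Polynomial.eval_mul, Polynomial.eval_comp]
  simp

/-- The `n`-th finite difference of `k ↦ (y + k)_d` vanishes for `d < n`. -/
theorem sum_neg_one_pow_choose_mul_ascPochhammer (y : ℝ) {d n : ℕ} (hd : d < n) :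
    ∑ k ∈ Finset.range (n + 1),
      (-1 : ℝ) ^ (n - k) * n.choose k * (ascPochhammer ℝ d).eval (y + k) = 0 := by
  have h1 : (fun t : ℝ => (ascPochhammer ℝ d).eval t) =
      fun t => ∑ k ∈ Finset.range n, (ascPochhammer ℝ d).coeff k * t ^ k := by
    funext t
    exact Polynomial.eval_eq_sum_range' (by rwa [ascPochhammer_natDegree]) t
  have h2 := congrFun (fwdDiff_iter_sum_mul_pow_eq_zero (n := n) (ascPochhammer ℝ d).coeff) y
  rw [← h1, fwdDiff_iter_eq_sum_shift] at h2
  simpa using h2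

/-- The coefficient of `f⁽ˡ⁻ʲ⁾` in the `l`-th component of `Γ_j f`, where `x = 2λ₀`. -/
def gamCoeff (x : ℝ) (l j : ℕ) : ℝ :=
  l.choose j / (ascPochhammer ℝ (l - j)).eval (x + 2 * j)

/-- The entries of the inverse of the matrix `gamCoeff x`. -/
def gamInvCoeff (x : ℝ) (i l : ℕ) : ℝ :=
  (-1) ^ (i - l) * i.choose l / (ascPochhammer ℝ (i - l)).eval (x + i + l - 1)

theorem gamCoeff_of_lt (x : ℝ) {l j : ℕ} (h : l < j) : gamCoeff x l j = 0 := by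
  simp [gamCoeff, Nat.choose_eq_zero_of_lt h]

theorem gamInvCoeff_of_lt (x : ℝ) {i l : ℕ} (h : i < l) : gamInvCoeff x i l = 0 := by
  simp [gamInvCoeff, Nat.choose_eq_zero_of_lt h]

/-- This sign pattern is what rules out cancellation in `gramLimit`. -/
theorem neg_one_pow_mul_gamInvCoeff_pos {x : ℝ} (hx : 0 < x) {i l : ℕ} (h : l ≤ i) :
    0 < (-1) ^ (i - l) * gamInvCoeff x i l := by
  have h1 : 0 < (ascPochhammer ℝ (i - l)).eval (x + i + l - 1) := by
    -- On the diagonal the argument may be negative, but the Pochhammer symbol is empty.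
    rcases h.eq_or_lt with rfl | h
    · simp
    · refine ascPochhammer_pos _ _ ?_
      have : (1 : ℝ) ≤ i := by exact_mod_cast (by omega : 1 ≤ i)
      have : (0 : ℝ) ≤ l := by positivity
      linarith
  have h2 : (0 : ℝ) < i.choose l := by exact_mod_cast Nat.choose_pos h
  rw [gamInvCoeff, mul_div_assoc, ← mul_assoc, ← mul_pow]
  norm_num
  positivity

/-- With y = x + 2j, the factorization (y)_{2n-1} = (y)_k (y+k)_{n-1} (y+k+n-1)_{n-k} gives all
products a common denominator. What is left is a term of the n-th finite difference of a polynomial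
of degree n - 1, so the sum over k vanishes. -/
theorem gamInvCoeff_mul_gamCoeff {x : ℝ} (hx : 0 < x) (j : ℕ) {n k : ℕ} (hn : n ≠ 0)
    (hk : k ≤ n) :
    gamInvCoeff x (j + n) (j + k) * gamCoeff x (j + k) j =
      (j + n).choose j / (ascPochhammer ℝ (n + n - 1)).eval (x + 2 * j) *
        ((-1 : ℝ) ^ (n - k) * n.choose k *
          (ascPochhammer ℝ (n - 1)).eval (x + 2 * j + k)) := by
  obtain ⟨d, rfl⟩ := Nat.exists_eq_succ_of_ne_zero hn
  obtain ⟨e, he⟩ := Nat.exists_eq_add_of_le hk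
  have hy : 0 < x + 2 * j := by positivity
  have h1 := ascPochhammer_eval_add (k + d) e (x + 2 * j)
  have h2 := ascPochhammer_eval_add k d (x + 2 * j)
  have h3 : ((j + d.succ).choose (j + k) : ℝ) * (j + k).choose j =
      (j + d.succ).choose j * d.succ.choose k := by
    have := Nat.choose_mul (n := j + d.succ) (k := j + k) (s := j) (by omega)
    simp only [Nat.add_sub_cancel_left] at this
    exact_mod_cast this
  have p1 := (ascPochhammer_pos k _ hy).ne'
  have p2 := (ascPochhammer_pos e (x + 2 * j + (k + d)) (by positivity)).ne'
  have p3 := (ascPochhammer_pos d (x + 2 * j + k) (by positivity)).ne'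
  have e1 : d.succ + d.succ - 1 = k + d + e := by omega
  have e2 : j + d.succ - (j + k) = e := by omega
  have e3 : d.succ - k = e := by omega
  have e4 : (x + (j + d.succ : ℕ) + (j + k : ℕ) - 1 : ℝ) = x + 2 * j + (k + d) := by
    push_cast; ring
  push_cast at h1
  rw [gamInvCoeff, gamCoeff, e1, e2, e3, e4, h1, h2, Nat.add_sub_cancel_left, Nat.succ_sub_one]
  field_simp
  linear_combination h3

theorem sum_gamInvCoeff_mul_gamCoeff {x : ℝ} (hx : 0 < x) {m i : ℕ} (hi : i ≤ m) (j : ℕ) :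
    ∑ l ∈ Finset.range (m + 1), gamInvCoeff x i l * gamCoeff x l j = if i = j then 1 else 0 := by
  rcases lt_or_ge i j with hij | hij
  · rw [if_neg hij.ne]
    refine Finset.sum_eq_zero fun l _ => ?_
    rcases lt_or_ge i l with h | h
    · rw [gamInvCoeff_of_lt x h, zero_mul]
    · rw [gamCoeff_of_lt x (by omega : l < j), mul_zero]
  obtain ⟨n, rfl⟩ := Nat.exists_eq_add_of_le hij
  have h1 : ∑ l ∈ Finset.range (m + 1), gamInvCoeff x (j + n) l * gamCoeff x l j =
      ∑ k ∈ Finset.range (n + 1), gamInvCoeff x (j + n) (j + k) * gamCoeff x (j + k) j := by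
    rw [← Finset.sum_subset (Finset.range_mono (by omega : j + (n + 1) ≤ m + 1)),
      Finset.sum_range_add, Finset.sum_eq_zero, zero_add]
    · intro l hl
      rw [gamCoeff_of_lt x (Finset.mem_range.1 hl), mul_zero]
    · intro l _ hl
      rw [gamInvCoeff_of_lt x (by rw [Finset.mem_range] at hl; omega), zero_mul]
  rw [h1]
  rcases eq_or_ne n 0 with rfl | hn
  · simp [gamInvCoeff, gamCoeff]
  · rw [if_neg (by omega), Finset.sum_congr rfl fun k hk => gamInvCoeff_mul_gamCoeff hx j hn
      (Nat.lt_succ_iff.1 (Finset.mem_range.1 hk)), ← Finset.mul_sum,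
      sum_neg_one_pow_choose_mul_ascPochhammer _ (by omega), mul_zero]

theorem gamInvMatrix_mul_gamMatrix {x : ℝ} (hx : 0 < x) (m : ℕ) :
    (Matrix.of fun i l : Fin (m + 1) => gamInvCoeff x i l) *
      (Matrix.of fun l j : Fin (m + 1) => gamCoeff x l j) = 1 := by
  ext i j
  rw [Matrix.mul_apply, Matrix.one_apply]
  simp only [Matrix.of_apply, Fin.ext_iff]
  rw [Fin.sum_univ_eq_sum_range (fun l => gamInvCoeff x i l * gamCoeff x l j),
    sum_gamInvCoeff_mul_gamCoeff hx (by omega)]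

theorem sum_gamCoeff_mul_gamInvCoeff {x : ℝ} (hx : 0 < x) {m : ℕ} (i j : Fin (m + 1)) :
    ∑ l : Fin (m + 1), gamCoeff x i l * gamInvCoeff x l j = if i = j then 1 else 0 := by
  have h0 := mul_eq_one_comm.1 (gamInvMatrix_mul_gamMatrix hx m)
  have h := congrFun (congrFun h0 i) j
  simpa [Matrix.mul_apply, Matrix.one_apply] using h

/-- The matrix `gamCoeff x` intertwines `c` with `-(l - j) * gamCoeff x l j`. -/
theorem exists_strictLower_gamCoeff_mul_eq {x : ℝ} (hx : 0 < x) (m : ℕ) :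
    ∃ c : Fin (m + 1) → Fin (m + 1) → ℝ,
      (∀ l j : Fin (m + 1), ∑ i : Fin (m + 1), gamCoeff x l i * c i j =
        -(((l : ℕ) - (j : ℕ) : ℕ) : ℝ) * gamCoeff x l j) ∧
      ∀ i j, i ≤ j → c i j = 0 := by
  -- The witness is the inverse matrix applied to the right-hand side. It is strictly lower
  -- triangular because the factor l - j kills the diagonal.
  refine ⟨fun i j => ∑ l : Fin (m + 1),
    gamInvCoeff x i l * (-(((l : ℕ) - (j : ℕ) : ℕ) : ℝ) * gamCoeff x l j), fun l j => ?_,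
    fun i j hij => Finset.sum_eq_zero fun l _ => ?_⟩
  · simp_rw [Finset.mul_sum, ← mul_assoc]
    rw [Finset.sum_comm]
    simp_rw [← Finset.sum_mul, sum_gamCoeff_mul_gamInvCoeff hx]
    simp
  · rcases lt_or_ge i l with h | h
    · rw [gamInvCoeff_of_lt x h, zero_mul]
    · rw [Nat.sub_eq_zero_of_le (Fin.le_def.1 (h.trans hij))]
      simp

/-! ### Asymptotics of factorials and Pochhammer symbols -/

/-- Euler's limit for Γ(y): dropping its last factor y + n, which is asymptotic to n, turns n^y into
n^{y-1}. -/
theorem tendsto_factorial_div_ascPochhammer {y : ℝ} (hy : 0 < y) :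
    Tendsto (fun n : ℕ => (n : ℝ) ^ (y - 1) * (n.factorial / (ascPochhammer ℝ n).eval y))
      atTop (𝓝 (Real.Gamma y)) := by
  have h1 := Real.GammaSeq_tendsto_Gamma y
  have h2 : Tendsto (fun n : ℕ => (y + n) / (n : ℝ)) atTop (𝓝 1) := by
    have := (tendsto_const_div_atTop_nhds_zero_nat y).add_const 1
    rw [zero_add] at this
    refine this.congr' ?_
    filter_upwards [eventually_gt_atTop 0] with n hn
    have : (n : ℝ) ≠ 0 := by positivity
    field_simp
  have h3 := h1.mul h2
  rw [mul_one] at h3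
  refine h3.congr' ?_
  filter_upwards [eventually_gt_atTop 0] with n hn
  have hn' : (0 : ℝ) < n := by positivity
  have h4 : ∏ j ∈ Finset.range (n + 1), (y + j) = (ascPochhammer ℝ n).eval y * (y + n) := by
    rw [← ascPochhammer_succ_eval]
    clear h1 h2 h3 hn hn'
    induction n + 1 with
    | zero => simp
    | succ k ih => rw [Finset.prod_range_succ, ih, ascPochhammer_succ_eval]
  have h5 := (ascPochhammer_pos n y hy).ne'
  rw [Real.GammaSeq, h4, Real.rpow_sub hn', Real.rpow_one]
  field_simp

theorem tendsto_natCast_add_div (a : ℤ) :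
    Tendsto (fun n : ℕ => ((n : ℝ) + a) / n) atTop (𝓝 1) := by
  have := (tendsto_const_div_atTop_nhds_zero_nat (a : ℝ)).const_add 1
  rw [add_zero] at this
  refine this.congr' ?_
  filter_upwards [eventually_gt_atTop 0] with n hn
  have : (n : ℝ) ≠ 0 := by positivity
  field_simp

theorem tendsto_factorial_div_ascPochhammer_shift {y : ℝ} (hy : 0 < y) (s i : ℕ) :
    Tendsto (fun n : ℕ => (n : ℝ) ^ (y - 1) *
        ((s + n - i).factorial / (ascPochhammer ℝ (s + n - i)).eval y))
      atTop (𝓝 (Real.Gamma y)) := by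
  have hN : Tendsto (fun n : ℕ => s + n - i) atTop atTop :=
    (tendsto_sub_atTop_nat i).comp (tendsto_atTop_mono (fun n => Nat.le_add_left n s) tendsto_id)
  have h1 := (tendsto_factorial_div_ascPochhammer hy).comp hN
  have h2 := ((tendsto_natCast_add_div (s - i)).rpow_const (p := y - 1) (by simp)).inv₀ (by simp)
  have h3 := h2.mul h1
  simp only [Real.one_rpow, inv_one, one_mul] at h3
  refine h3.congr' ?_
  filter_upwards [eventually_gt_atTop i] with n hn
  have hn' : (0 : ℝ) < n := by exact_mod_cast (by omega : 0 < n)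
  have e : ((s + n - i : ℕ) : ℝ) = (n : ℝ) + ((s - i : ℤ) : ℝ) := by
    rw [Nat.cast_sub (by omega)]; push_cast; ring
  have hpos : (0 : ℝ) < (n : ℝ) + ((s - i : ℤ) : ℝ) := by
    rw [← e]; exact_mod_cast (by omega : 0 < s + n - i)
  simp only [Function.comp]
  rw [e, Real.div_rpow hpos.le hn'.le]
  have := (Real.rpow_pos_of_pos hpos (y - 1)).ne'
  field_simp

theorem tendsto_descFactorial_div_pow (p a : ℕ) :
    Tendsto (fun n : ℕ => ((p + n).descFactorial a : ℝ) / (n : ℝ) ^ a) atTop (𝓝 1) := by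
  induction a with
  | zero => simp
  | succ a ih =>
    have h := (tendsto_natCast_add_div (p - a)).mul ih
    rw [one_mul] at h
    refine h.congr' ?_
    filter_upwards [eventually_gt_atTop a] with n hn
    rw [Nat.descFactorial_succ, Nat.cast_mul, Nat.cast_sub (by omega), pow_succ, div_mul_div_comm]
    push_cast
    ring

/-! ### Derivatives on the disc and comparison of weights -/

theorem iteratedDeriv_congr_unitBall {φ ψ : ℂ → ℂ} (h : ∀ z, ‖z‖ < 1 → φ z = ψ z) (k : ℕ)
    {z : ℂ} (hz : ‖z‖ < 1) : iteratedDeriv k φ z = iteratedDeriv k ψ z := by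
  refine Filter.EventuallyEq.iteratedDeriv_eq k ?_
  filter_upwards [Metric.isOpen_ball.mem_nhds (mem_ball_zero_iff.2 hz)] with w hw
  exact h w (mem_ball_zero_iff.1 hw)

theorem iteratedDeriv_id_mul {φ : ℂ → ℂ} (hφ : DifferentiableOn ℂ φ (Metric.ball 0 1)) (k : ℕ)
    {z : ℂ} (hz : ‖z‖ < 1) :
    iteratedDeriv k (fun w => w * φ w) z =
      z * iteratedDeriv k φ z + k * iteratedDeriv (k - 1) φ z := by
  have hd : ∀ (n : ℕ) {w : ℂ}, ‖w‖ < 1 → DifferentiableAt ℂ (iteratedDeriv n φ) w := by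
    intro n w hw
    rw [iteratedDeriv_eq_iterate]
    exact ((hφ.analyticAt (Metric.isOpen_ball.mem_nhds (by simpa using hw))).iterated_deriv
      n).differentiableAt
  induction k generalizing z with
  | zero => simp
  | succ k ih =>
    have h1 : deriv (iteratedDeriv k fun w => w * φ w) z =
        deriv (fun w => w * iteratedDeriv k φ w + k * iteratedDeriv (k - 1) φ w) z := by
      refine Filter.EventuallyEq.deriv_eq ?_
      filter_upwards [Metric.isOpen_ball.mem_nhds (mem_ball_zero_iff.2 hz)] with w hw
      exact ih (mem_ball_zero_iff.1 hw)
    have h2 := ((hasDerivAt_id z).fun_mul (hd k hz).hasDerivAt).fun_add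
      ((hd (k - 1) hz).hasDerivAt.const_mul (k : ℂ))
    simp only [id] at h2
    rw [iteratedDeriv_succ, h1, h2.deriv, ← iteratedDeriv_succ, ← iteratedDeriv_succ]
    rcases k with _ | k
    · simp; ring
    · simp; ring

theorem iteratedDeriv_iteratedDeriv (a b : ℕ) (φ : ℂ → ℂ) :
    iteratedDeriv a (iteratedDeriv b φ) = iteratedDeriv (a + b) φ := by
  simp only [iteratedDeriv_eq_iterate, Function.iterate_add_apply]

theorem weight_succ_sq {lam : ℝ} (h : 0 < lam) (n : ℕ) :
    weight lam (n + 1) ^ 2 = weight lam n ^ 2 * ((2 * lam + n) / (n + 1)) := by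
  have : (n.factorial : ℝ) ≠ 0 := by positivity
  rw [weight_sq h, weight_sq h, ascPochhammer_succ_eval, Nat.factorial_succ]
  push_cast
  field_simp

theorem weight_le_weight_add_one {lam : ℝ} (h : 0 < lam) (n : ℕ) :
    weight lam n ≤ weight (lam + 1) n := by
  rw [← sq_le_sq₀ (weight_pos h n).le (weight_pos (by positivity) n).le]
  induction n with
  | zero => simp [weight]
  | succ n ih =>
    rw [weight_succ_sq h, weight_succ_sq (by positivity)]
    gcongr
    linarith

theorem weight_le_mul_weight_succ {lam : ℝ} (h : 0 < lam) (n : ℕ) :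
    weight lam n ^ 2 ≤ (1 + 1 / (2 * lam)) * weight lam (n + 1) ^ 2 := by
  have hw := weight_pos h n
  -- The inverse ratio (n + 1)/(2λ + n) lies between its value 1/(2λ) at n = 0 and its limit 1; the
  -- constant is the sum of the two.
  have h1 : 1 ≤ (1 + 1 / (2 * lam)) * ((2 * lam + n) / (n + 1)) := by
    have : (0 : ℝ) ≤ n := by positivity
    field_simp
    nlinarith [mul_pos h h, mul_nonneg h.le this]
  rw [weight_succ_sq h]
  nlinarith [sq_nonneg (weight lam n)]

/-- Since 2λ(2λ+1)(2λ+2)_n = (2λ)_{n+2} = (2λ)_{n+1}(2λ+n+1), this reduces to n + 1 ≤ 2λ + n + 1. It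
makes differentiation bounded from A^{(λ)} to A^{(λ+1)}. -/
theorem weight_add_one_sq {lam : ℝ} (h : 0 < lam) (n : ℕ) :
    ((n : ℝ) + 1) ^ 2 * weight lam (n + 1) ^ 2 ≤
      2 * lam * (2 * lam + 1) * weight (lam + 1) n ^ 2 := by
  have h1 := ascPochhammer_eval_add 2 n (2 * lam)
  have h2 := ascPochhammer_succ_eval (n + 1) (2 * lam)
  have h3 : (ascPochhammer ℝ 2).eval (2 * lam) = 2 * lam * (2 * lam + 1) := by
    simp [ascPochhammer_succ_eval]
  have h4 := ascPochhammer_pos (n + 1) (2 * lam) (by positivity)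
  have h5 : (0 : ℝ) < n.factorial := by positivity
  rw [show n + 1 + 1 = 2 + n by ring, h1, h3] at h2
  push_cast at h2
  rw [weight_sq h, weight_sq (by positivity), mul_div_assoc', mul_div_assoc',
    show 2 * (lam + 1) = 2 * lam + 2 by ring, h2, Nat.factorial_succ]
  push_cast
  field_simp
  linarith

/-! ### Inclusion, multiplication and differentiation on the spaces A^{(λ)} -/

namespace Berg

variable {lam : ℝ} {h : 0 < lam}

/-- The orthonormal basis `√((2λ)ₙ / n!) zⁿ` of `A^{(λ)}(𝔻)`. -/
def basis (lam : ℝ) (h : 0 < lam) (n : ℕ) : Berg lam h := lp.single 2 n (1 : ℂ)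

theorem inner_basis (f : Berg lam h) (n : ℕ) : ⟪basis lam h n, f⟫_ℂ = coord f n := by
  have := lp.inner_single_left (𝕜 := ℂ) (G := fun _ : ℕ => ℂ) n 1 f
  refine this.trans ?_
  simp [coord]

theorem coord_basis (n k : ℕ) : coord (basis lam h n) k = if k = n then 1 else 0 := by
  simp [coord, basis, lp.single_apply, Pi.single_apply]

theorem fn_basis (n : ℕ) (z : ℂ) : fn (basis lam h n) z = weight lam n * z ^ n := by
  rw [fn, tsum_eq_single n]
  · simp [coord_basis]
  · intro k hk
    simp [coord_basis, hk]

theorem hasSum_basis (f : Berg lam h) : HasSum (fun n => coord f n • basis lam h n) f := by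
  have := lp.hasSum_single (p := 2) (E := fun _ : ℕ => ℂ) (by simp) f
  refine this.congr_fun fun n => ?_
  have h2 := lp.single_smul (E := fun _ : ℕ => ℂ) 2 n (coord f n) (1 : ℂ)
  rw [smul_eq_mul, mul_one] at h2
  exact h2.symm

theorem iteratedDeriv_fn_basis (n k : ℕ) (z : ℂ) :
    iteratedDeriv k (fn (basis lam h n)) z =
      weight lam n * (n.descFactorial k * z ^ (n - k)) := by
  rw [show fn (basis lam h n) = fun z => (weight lam n : ℂ) * z ^ n from funext (fn_basis n),
    iteratedDeriv_const_mul_field, iteratedDeriv_pow]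

theorem hasSum_iteratedDeriv_fn (f : Berg lam h) (k : ℕ) {z : ℂ} (hz : ‖z‖ < 1) :
    HasSum (fun n => coord f n * (weight lam n * (n.descFactorial k * z ^ (n - k))))
      (iteratedDeriv k (fn f) z) := by
  refine ((hasSum_basis f).mapL (derivCLM lam h k ⟨z, by simpa using hz⟩)).congr_fun fun n => ?_
  rw [map_smul, smul_eq_mul, ← iteratedDeriv_fn_basis (h := h)]
  rfl

theorem summable_coord (f : Berg lam h) : Summable fun n => ‖coord f n‖ ^ 2 := by
  have := (memℓp_gen_iff (p := 2) (by norm_num)).1 (lp.memℓp (E := fun _ : ℕ => ℂ) (p := 2) f)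
  simpa [coord] using this

theorem exists_coord (h : 0 < lam) {c : ℕ → ℂ} (hc : Summable fun n => ‖c n‖ ^ 2) :
    ∃ g : Berg lam h, ∀ n, coord g n = c n :=
  ⟨(⟨c, (memℓp_gen_iff (p := 2) (by norm_num)).2 (by simpa using hc)⟩ :
    lp (fun _ : ℕ => ℂ) 2), fun _ => rfl⟩

/-- In orthonormal coordinates, inclusion (d = 0) and differentiation (d = 1) are backward shifts
with bounded multipliers. -/
theorem exists_coord_of_le (f : Berg lam h) {lam' : ℝ} (h' : 0 < lam') (d : ℕ) {c : ℕ → ℂ}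
    {C : ℝ} (hc : ∀ n, ‖c n‖ ≤ C) :
    ∃ g : Berg lam' h', ∀ n, coord g n = c n * coord f (n + d) := by
  refine exists_coord h' (Summable.of_nonneg_of_le (fun n => by positivity) (fun n => ?_)
    (((summable_nat_add_iff d).2 (summable_coord f)).mul_left (C ^ 2)))
  rw [norm_mul, mul_pow]
  have := (norm_nonneg _).trans (hc n)
  gcongr
  exact hc n

theorem exists_fn_eq (f : Berg lam h) {lam' : ℝ} (h' : lam' = lam + 1) (h0 : 0 < lam') :
    ∃ g : Berg lam' h0, ∀ z, ‖z‖ < 1 → fn g z = fn f z := by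
  subst h'
  obtain ⟨g, hg⟩ := exists_coord_of_le f h0 0 (c := fun n => (weight lam n / weight (lam + 1) n : ℝ))
    (C := 1) fun n => by
      rw [Complex.norm_real, Real.norm_of_nonneg
        (div_nonneg (weight_pos h n).le (weight_pos h0 n).le)]
      exact div_le_one_of_le₀ (weight_le_weight_add_one h n) (weight_pos h0 n).le
  refine ⟨g, fun z hz => tsum_congr fun n => ?_⟩
  have : (weight (lam + 1) n : ℂ) ≠ 0 := by exact_mod_cast (weight_pos h0 n).ne'
  rw [hg, add_zero]
  push_cast
  field_simp

theorem exists_fn_eq_id_mul (f : Berg lam h) :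
    ∃ g : Berg lam h, ∀ z, ‖z‖ < 1 → fn g z = z * fn f z := by
  obtain ⟨g, hg⟩ : ∃ g : Berg lam h, ∀ n, coord g n = Nat.casesOn n 0 fun n =>
      ((weight lam n / weight lam (n + 1) : ℝ) : ℂ) * coord f n := by
    refine exists_coord h ((summable_nat_add_iff 1).1 (Summable.of_nonneg_of_le
      (fun n => by positivity) (fun n => ?_)
      ((summable_coord f).mul_left (1 + 1 / (2 * lam)))))
    have hw := weight_pos h (n + 1)
    simp only [norm_mul, mul_pow, Complex.norm_real, Real.norm_eq_abs, sq_abs, div_pow]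
    gcongr
    rw [div_le_iff₀ (by positivity)]
    exact weight_le_mul_weight_succ h n
  refine ⟨g, fun z hz => ?_⟩
  rw [fn, (hasSum_fn g hz).summable.tsum_eq_zero_add, fn, ← tsum_mul_left,
    show coord g 0 = 0 from hg 0, mul_zero, zero_mul, zero_add]
  refine tsum_congr fun n => ?_
  have : (weight lam (n + 1) : ℂ) ≠ 0 := by exact_mod_cast (weight_pos h (n + 1)).ne'
  rw [hg]
  push_cast
  field_simp
  ring

theorem exists_fn_eq_deriv (f : Berg lam h) (h0 : 0 < lam + 1) :
    ∃ g : Berg (lam + 1) h0, ∀ z, ‖z‖ < 1 → fn g z = deriv (fn f) z := by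
  obtain ⟨g, hg⟩ := exists_coord_of_le f h0 1
    (c := fun n => (((n + 1) * weight lam (n + 1) / weight (lam + 1) n : ℝ) : ℂ))
    (C := √(2 * lam * (2 * lam + 1))) fun n => by
      have hw := weight_pos h0 n
      rw [Complex.norm_real, Real.norm_eq_abs]
      refine Real.abs_le_sqrt ?_
      rw [div_pow, mul_pow, div_le_iff₀ (by positivity)]
      exact weight_add_one_sq h n
  refine ⟨g, fun z hz => ?_⟩
  have h1 := hasSum_iteratedDeriv_fn f 1 hz
  rw [iteratedDeriv_one] at h1
  rw [← h1.tsum_eq, h1.summable.tsum_eq_zero_add, fn]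
  simp only [Nat.descFactorial_one, Nat.cast_zero, zero_mul, mul_zero, zero_add,
    Nat.add_sub_cancel]
  refine tsum_congr fun n => ?_
  have : (weight (lam + 1) n : ℂ) ≠ 0 := by exact_mod_cast (weight_pos h0 n).ne'
  rw [hg]
  push_cast
  field_simp

/-- Each derivative raises λ by one, and a final inclusion supplies the extra one. With d = i - j -
1 the target is exactly A^{(λ_i)}, as λ_i = λ_j + (i - j). -/
theorem exists_fn_eq_iteratedDeriv (d : ℕ) {lam : ℝ} {h : 0 < lam} (f : Berg lam h) {lam' : ℝ}
    (h' : lam' = lam + d + 1) (h0 : 0 < lam') :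
    ∃ g : Berg lam' h0, ∀ z, ‖z‖ < 1 → fn g z = iteratedDeriv d (fn f) z := by
  induction d generalizing lam with
  | zero => simpa using exists_fn_eq f (by simpa using h') h0
  | succ d ih =>
    obtain ⟨f', hf'⟩ := exists_fn_eq_deriv f (by positivity)
    obtain ⟨g, hg⟩ := ih f' (by rw [h']; push_cast; ring)
    exact ⟨g, fun z hz => by
      rw [hg z hz, iteratedDeriv_succ', iteratedDeriv_congr_unitBall hf' d hz]⟩

end Berg

/-! ### Multiplication by z is well defined and bounded -/

theorem two_mul_lamj (m : ℕ) (lam : ℝ) (j : Fin (m + 1)) :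
    2 * lamj m lam j = 2 * lam - m + 2 * (j : ℕ) := by
  rw [lamj]; ring

theorem Gam_apply_eq_gamCoeff {m : ℕ} {lam : ℝ} (hlam : (m : ℝ) / 2 < lam) (j : Fin (m + 1))
    (z : 𝔻) (f : Berg (lamj m lam j) (lamj_pos hlam j)) (l : Fin (m + 1)) :
    Gam hlam j z f l =
      (gamCoeff (2 * lam - m) l j : ℂ) * iteratedDeriv ((l : ℕ) - j) f.fn z := by
  rw [Gam_apply, gamCoeff, two_mul_lamj]
  split_ifs with hjl
  · push_cast; rfl
  · rw [Nat.choose_eq_zero_of_lt (by simpa using hjl)]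
    simp

/-- Multiplication by `z` maps the range of `Γ_j` to the sum of the ranges of the `Γ_i`. -/
theorem exists_sum_Gam_eq_smul_Gam {m : ℕ} {lam : ℝ} (hlam : (m : ℝ) / 2 < lam)
    (j : Fin (m + 1)) (f : Berg (lamj m lam j) (lamj_pos hlam j)) :
    ∃ G : ∀ i : Fin (m + 1), Berg (lamj m lam i) (lamj_pos hlam i),
      ∀ z : 𝔻, ∑ i, Gam hlam i z (G i) = (z : ℂ) • Gam hlam j z f := by
  obtain ⟨c, hc, hc0⟩ := exists_strictLower_gamCoeff_mul_eq
    (x := 2 * lam - m) (by linarith) m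
  -- The components are z f for i = j, c_{ij} f^{(i-j-1)} for i > j, and 0 for i < j. The truncated
  -- subtraction is harmless because c_{ij} = 0 for i ≤ j.
  have key : ∀ i : Fin (m + 1), ∃ g : Berg (lamj m lam i) (lamj_pos hlam i), ∀ (k : ℕ) (z : ℂ),
      ‖z‖ < 1 → iteratedDeriv k g.fn z =
        (if i = j then z * iteratedDeriv k f.fn z + k * iteratedDeriv (k - 1) f.fn z else 0) +
          c i j * iteratedDeriv (k + ((i : ℕ) - j - 1)) f.fn z := by
    intro i
    rcases lt_trichotomy i j with hij | rfl | hij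
    · refine ⟨0, fun k z hz => ?_⟩
      rw [if_neg hij.ne, hc0 i j hij.le, Complex.ofReal_zero, zero_mul, add_zero]
      exact (Berg.derivCLM _ (lamj_pos hlam i) k ⟨z, by simpa using hz⟩).map_zero
    · obtain ⟨g, hg⟩ := Berg.exists_fn_eq_id_mul f
      refine ⟨g, fun k z hz => ?_⟩
      rw [if_pos rfl, hc0 i i le_rfl, Complex.ofReal_zero, zero_mul, add_zero,
        iteratedDeriv_congr_unitBall hg k hz,
        iteratedDeriv_id_mul (Berg.differentiableOn_fn f) k hz]
    · obtain ⟨g, hg⟩ := Berg.exists_fn_eq_iteratedDeriv ((i : ℕ) - j - 1) f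
        (lam' := lamj m lam i) (by
          rw [lamj, lamj, Nat.sub_sub, Nat.cast_sub (by omega)]
          push_cast
          ring) (lamj_pos hlam i)
      refine ⟨(c i j : ℂ) • g, fun k z hz => ?_⟩
      rw [if_neg hij.ne', zero_add, ← iteratedDeriv_iteratedDeriv,
        ← iteratedDeriv_congr_unitBall hg k hz]
      exact (Berg.derivCLM _ (lamj_pos hlam i) k ⟨z, by simpa using hz⟩).map_smul (c i j : ℂ) g
  choose G hG using key
  refine ⟨G, fun z => PiLp.ext fun l => ?_⟩
  -- The total order (l - i) + (i - j - 1) = l - j - 1 does not depend on i, so the derivative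
  -- factors out and `hc` cancels the Leibniz term of z f.
  have h1 : ∀ i : Fin (m + 1), (gamCoeff (2 * lam - m) l i : ℂ) *
      (c i j * iteratedDeriv ((l : ℕ) - i + ((i : ℕ) - j - 1)) f.fn z) =
      ((gamCoeff (2 * lam - m) l i * c i j : ℝ) : ℂ) *
        iteratedDeriv ((l : ℕ) - j - 1) f.fn z := by
    intro i
    rcases lt_or_ge (l : ℕ) i with hli | hli
    · simp [gamCoeff_of_lt _ hli]
    rcases le_or_gt i j with hij | hij
    · simp [hc0 i j hij]
    · rw [show (l : ℕ) - i + ((i : ℕ) - j - 1) = (l : ℕ) - j - 1 by omega]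
      push_cast
      ring
  rw [WithLp.ofLp_sum, Finset.sum_apply, WithLp.ofLp_smul, Pi.smul_apply, smul_eq_mul]
  simp_rw [Gam_apply_eq_gamCoeff, hG _ _ _ z.norm_lt_one, mul_add, h1]
  rw [Finset.sum_add_distrib, ← Finset.sum_mul, ← Complex.ofReal_sum, hc]
  simp only [mul_ite, mul_zero, Finset.sum_ite_eq', Finset.mem_univ, if_true]
  push_cast
  ring

namespace ASpace

variable {m : ℕ} {lam : ℝ} {mu : Fin (m + 1) → ℝ} {hlam : (m : ℝ) / 2 < lam}
  {hmu : ∀ j, 0 < mu j}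

/-- The element `∑_j μ_j Γ_j f_j` of `A^{(λ,μ)}(𝔻)`. -/
def ofComp (hlam : (m : ℝ) / 2 < lam) (mu : Fin (m + 1) → ℝ) (hmu : ∀ j, 0 < mu j)
    (f : ∀ j : Fin (m + 1), Berg (lamj m lam j) (lamj_pos hlam j)) :
    ASpace m lam mu hlam hmu :=
  (WithLp.toLp 2 f : PiLp 2 fun j : Fin (m + 1) => Berg (lamj m lam j) (lamj_pos hlam j))

@[simp]
theorem comp_ofComp (f : ∀ j : Fin (m + 1), Berg (lamj m lam j) (lamj_pos hlam j))
    (j : Fin (m + 1)) : comp j (ofComp hlam mu hmu f) = f j := rfl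

theorem inner_eq_sum (f g : ASpace m lam mu hlam hmu) :
    ⟪f, g⟫_ℂ = ∑ j, ⟪comp j f, comp j g⟫_ℂ :=
  PiLp.inner_apply (𝕜 := ℂ)
    (f := fun j : Fin (m + 1) => Berg (lamj m lam j) (lamj_pos hlam j)) f g

theorem exists_eq_smul (f : ASpace m lam mu hlam hmu) :
    ∃ g : ASpace m lam mu hlam hmu, ∀ z : 𝔻, g z = (z : ℂ) • f z := by
  choose G hG using fun j => exists_sum_Gam_eq_smul_Gam hlam j (comp j f)
  refine ⟨ofComp hlam mu hmu fun i => ∑ j, ((mu j : ℂ) / mu i) • G j i, fun z => ?_⟩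
  have h1 : ∀ i j, (mu i : ℂ) * (mu j / mu i) = mu j := fun i j =>
    mul_div_cancel₀ _ (by exact_mod_cast (hmu i).ne')
  simp_rw [coe_apply, comp_ofComp, map_sum, map_smul, Finset.smul_sum, smul_smul, h1]
  rw [Finset.sum_comm]
  simp_rw [← Finset.smul_sum, hG, smul_smul, mul_comm]

/-- The operator of multiplication by `z` is well defined and bounded. -/
theorem exists_mulCLM : ∃ M : ASpace m lam mu hlam hmu →L[ℂ] ASpace m lam mu hlam hmu,
    ∀ (f : ASpace m lam mu hlam hmu) (z : 𝔻), M f z = (z : ℂ) • f z := by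
  choose T hT using exists_eq_smul (m := m) (lam := lam) (mu := mu) (hlam := hlam) (hmu := hmu)
  let L : ASpace m lam mu hlam hmu →ₗ[ℂ] ASpace m lam mu hlam hmu :=
    { toFun := T
      map_add' := fun f g => RKHS.ext fun z => by
        simp [hT]
      map_smul' := fun c f => RKHS.ext fun z => by
        simp [hT, smul_comm c] }
  -- The graph is closed because point evaluations are continuous and separate elements.
  refine ⟨ContinuousLinearMap.ofSeqClosedGraph (g := L) fun u f g hu hLu =>
    RKHS.ext fun z => ?_, hT⟩
  have h1 := ((eval z).continuous.tendsto g).comp hLu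
  have h2 := (((eval z).continuous.tendsto f).comp hu).const_smul (z : ℂ)
  refine (tendsto_nhds_unique h1 (h2.congr fun n => ?_)).trans (hT f z).symm
  exact (hT (u n) z).symm

end ASpace

/-! ### Monomials z^p e_l and their inner products -/

namespace ASpace

variable {m : ℕ} {lam : ℝ} {mu : Fin (m + 1) → ℝ} {hlam : (m : ℝ) / 2 < lam}
  {hmu : ∀ j, 0 < mu j}

/-- The vectors of the orthonormal basis of `A^{(λ,μ)}(𝔻)` coming from the orthonormal bases
of the `A^{(λ_j)}(𝔻)`. -/
def basisVec (hlam : (m : ℝ) / 2 < lam) (mu : Fin (m + 1) → ℝ) (hmu : ∀ j, 0 < mu j)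
    (j : Fin (m + 1)) (n : ℕ) : ASpace m lam mu hlam hmu :=
  ofComp hlam mu hmu (Pi.single j (Berg.basis _ (lamj_pos hlam j) n))

/-- The coefficients of the components of the function `zᵖ e_l`. -/
def monomialCoeff (lam : ℝ) (mu : Fin (m + 1) → ℝ) (p : ℕ) (l i : Fin (m + 1)) : ℝ :=
  gamInvCoeff (2 * lam - m) i l * p.descFactorial ((i : ℕ) - l) /
    (mu i * weight (lamj m lam i) (p + l - i))

/-- The function `zᵖ e_l` as an element of `A^{(λ,μ)}(𝔻)`. -/
def monomial (hlam : (m : ℝ) / 2 < lam) (mu : Fin (m + 1) → ℝ) (hmu : ∀ j, 0 < mu j)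
    (p : ℕ) (l : Fin (m + 1)) : ASpace m lam mu hlam hmu :=
  ofComp hlam mu hmu fun i =>
    (monomialCoeff lam mu p l i : ℂ) • Berg.basis _ (lamj_pos hlam i) (p + l - i)

/-- Ensures that the subtraction in the index p + l - i is never truncated where it matters. -/
theorem le_of_monomialCoeff_ne_zero {p : ℕ} {l i : Fin (m + 1)}
    (h : monomialCoeff lam mu p l i ≠ 0) : l ≤ i ∧ (i : ℕ) ≤ p + l := by
  have h1 : l ≤ i := by
    by_contra hli
    exact h (by simp [monomialCoeff, gamInvCoeff_of_lt _ (Fin.lt_def.1 (not_le.1 hli))])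
  refine ⟨h1, ?_⟩
  by_contra hi
  exact h (by simp [monomialCoeff, Nat.descFactorial_eq_zero_iff_lt.2
    (by omega : p < (i : ℕ) - l)])

theorem inner_basisVec (f : ASpace m lam mu hlam hmu) (j : Fin (m + 1)) (n : ℕ) :
    ⟪basisVec hlam mu hmu j n, f⟫_ℂ = Berg.coord (comp j f) n := by
  rw [inner_eq_sum, Finset.sum_eq_single j]
  · simp [basisVec, Berg.inner_basis]
  · intro i _ hij
    simp [basisVec, hij]
  · simp

theorem eq_zero_of_inner_basisVec (f : ASpace m lam mu hlam hmu)
    (hf : ∀ j n, ⟪basisVec hlam mu hmu j n, f⟫_ℂ = 0) : f = 0 := by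
  refine PiLp.ext fun j => lp.ext (E := fun _ : ℕ => ℂ) (p := 2) (funext fun n => ?_)
  exact (inner_basisVec f j n).symm.trans (hf j n)

theorem inner_basisVec_basisVec (i j : Fin (m + 1)) (q n : ℕ) :
    ⟪basisVec hlam mu hmu j n, basisVec hlam mu hmu i q⟫_ℂ =
      if i = j then if q = n then 1 else 0 else 0 := by
  rw [inner_basisVec, basisVec, comp_ofComp]
  rcases eq_or_ne i j with rfl | hij
  · rw [Pi.single_eq_same, Berg.coord_basis, if_pos rfl]
    simp only [eq_comm]
  · rw [Pi.single_eq_of_ne hij.symm, if_neg hij]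
    rfl

theorem Gam_basis (j l : Fin (m + 1)) (n : ℕ) (z : 𝔻) :
    Gam hlam j z (Berg.basis _ (lamj_pos hlam j) n) l =
      (gamCoeff (2 * lam - m) l j : ℂ) * (weight (lamj m lam j) n *
        (n.descFactorial ((l : ℕ) - j) * (z : ℂ) ^ (n - ((l : ℕ) - j)))) := by
  rw [Gam_apply_eq_gamCoeff, Berg.iteratedDeriv_fn_basis]

/-- The i-th component is a multiple of the (i-l)-th derivative of z^p. Applying Γ_i produces the
(r-l)-th derivative whatever i is, and summing over i multiplies the coefficient matrix by its
inverse, leaving only r = l. -/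
theorem monomial_apply (p : ℕ) (l : Fin (m + 1)) (z : 𝔻) :
    monomial hlam mu hmu p l z = (z : ℂ) ^ p • EuclideanSpace.single l (1 : ℂ) := by
  refine PiLp.ext fun r => ?_
  have hx : 0 < 2 * lam - m := by linarith
  have key : ∀ i : Fin (m + 1), (mu i : ℂ) * ((monomialCoeff lam mu p l i : ℂ) *
      ((gamCoeff (2 * lam - m) r i : ℂ) * (weight (lamj m lam i) (p + l - i) *
        ((p + l - i).descFactorial ((r : ℕ) - i) *
          (z : ℂ) ^ (p + l - i - ((r : ℕ) - i)))))) =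
      ((gamCoeff (2 * lam - m) r i * gamInvCoeff (2 * lam - m) i l : ℝ) : ℂ) *
        (p.descFactorial ((r : ℕ) - l) * (z : ℂ) ^ (p + l - r)) := by
    intro i
    rcases lt_or_ge (r : ℕ) i with hri | hri
    · simp [gamCoeff_of_lt _ hri]
    rcases lt_or_ge (i : ℕ) l with hil | hil
    · simp [gamInvCoeff_of_lt _ hil, monomialCoeff]
    have h1 := Nat.descFactorial_mul_descFactorial (n := p)
      (by omega : (i : ℕ) - l ≤ (r : ℕ) - l)
    rw [show p - ((i : ℕ) - l) = p + l - i by omega,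
      show (r : ℕ) - l - ((i : ℕ) - l) = (r : ℕ) - i by omega] at h1
    have h2 : (mu i : ℂ) ≠ 0 := by exact_mod_cast (hmu i).ne'
    have h3 : (weight (lamj m lam i) (p + l - i) : ℂ) ≠ 0 := by
      exact_mod_cast (weight_pos (lamj_pos hlam i) _).ne'
    rw [← h1, show p + l - i - ((r : ℕ) - i) = p + l - r by omega, monomialCoeff]
    push_cast
    field_simp
  rw [coe_apply, WithLp.ofLp_sum, Finset.sum_apply]
  simp only [monomial, comp_ofComp, map_smul, WithLp.ofLp_smul, Pi.smul_apply, smul_eq_mul,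
    Gam_basis, key]
  rw [← Finset.sum_mul, ← Complex.ofReal_sum, sum_gamCoeff_mul_gamInvCoeff hx]
  rcases eq_or_ne r l with rfl | h
  · simp
  · simp [h]

/-- Each component of Γ_j z^n is itself a monomial. When n + j < l the exponent is truncated, but
the falling factorial vanishes. -/
theorem basisVec_eq_sum (j : Fin (m + 1)) (n : ℕ) :
    basisVec hlam mu hmu j n = ∑ l : Fin (m + 1),
      ((mu j * (gamCoeff (2 * lam - m) l j *
        (weight (lamj m lam j) n * n.descFactorial ((l : ℕ) - j))) : ℝ) : ℂ) •
        monomial hlam mu hmu (n + j - l) l := by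
  refine RKHS.ext fun z => PiLp.ext fun r => ?_
  have h1 : basisVec hlam mu hmu j n z =
      (mu j : ℂ) • Gam hlam j z (Berg.basis _ (lamj_pos hlam j) n) := by
    rw [coe_apply, Finset.sum_eq_single j]
    · simp [basisVec]
    · intro i _ hij
      simp [basisVec, hij]
    · simp
  have h2 : (∑ l : Fin (m + 1),
      ((mu j * (gamCoeff (2 * lam - m) l j *
        (weight (lamj m lam j) n * n.descFactorial ((l : ℕ) - j))) : ℝ) : ℂ) •
        monomial hlam mu hmu (n + j - l) l) z = ∑ l : Fin (m + 1),
      ((mu j * (gamCoeff (2 * lam - m) l j *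
        (weight (lamj m lam j) n * n.descFactorial ((l : ℕ) - j))) : ℝ) : ℂ) •
        (z : ℂ) ^ (n + j - l) • EuclideanSpace.single l (1 : ℂ) := by
    change eval z _ = _
    rw [map_sum]
    refine Finset.sum_congr rfl fun l _ => ?_
    rw [map_smul, ← monomial_apply (hlam := hlam) (mu := mu) (hmu := hmu)]
    rfl
  rw [h1, h2, WithLp.ofLp_smul, Pi.smul_apply, Gam_basis, WithLp.ofLp_sum, Finset.sum_apply,
    Finset.sum_eq_single r]
  · rcases lt_or_ge (r : ℕ) j with hrj | hrj
    · simp [gamCoeff_of_lt _ hrj]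
    · simp [show n - ((r : ℕ) - j) = n + j - r by omega]
      ring
  · intro l _ hl
    simp [hl.symm]
  · simp

theorem inner_monomial (p q : ℕ) (l r : Fin (m + 1)) :
    ⟪monomial hlam mu hmu p l, monomial hlam mu hmu q r⟫_ℂ =
      ∑ i : Fin (m + 1), (monomialCoeff lam mu p l i : ℂ) * (monomialCoeff lam mu q r i *
        if p + l - i = q + r - i then 1 else 0) := by
  rw [inner_eq_sum]
  refine Finset.sum_congr rfl fun i _ => ?_
  rw [monomial, monomial, comp_ofComp, comp_ofComp, inner_smul_left, inner_smul_right,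
    Berg.inner_basis, Berg.coord_basis, Complex.conj_ofReal]

theorem inner_monomial_eq_sum (p : ℕ) (l : Fin (m + 1)) (f : ASpace m lam mu hlam hmu) :
    ⟪monomial hlam mu hmu p l, f⟫_ℂ = ∑ i : Fin (m + 1),
      (monomialCoeff lam mu p l i : ℂ) * ⟪basisVec hlam mu hmu i (p + l - i), f⟫_ℂ := by
  rw [inner_eq_sum]
  refine Finset.sum_congr rfl fun i _ => ?_
  rw [monomial, comp_ofComp, inner_smul_left, Berg.inner_basis, Complex.conj_ofReal,
    inner_basisVec]

theorem inner_monomial_of_ne {p q : ℕ} {l r : Fin (m + 1)} (h : p + l ≠ q + r) :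
    ⟪monomial hlam mu hmu p l, monomial hlam mu hmu q r⟫_ℂ = 0 := by
  rw [inner_monomial]
  refine Finset.sum_eq_zero fun i _ => ?_
  by_cases h1 : monomialCoeff lam mu p l i = 0
  · simp [h1]
  by_cases h2 : monomialCoeff lam mu q r i = 0
  · simp [h2]
  have := le_of_monomialCoeff_ne_zero h1
  have := le_of_monomialCoeff_ne_zero h2
  rw [if_neg (by omega), mul_zero, mul_zero]

theorem inner_monomial_of_eq {p q : ℕ} {l r : Fin (m + 1)} (h : p + l = q + r) :
    ⟪monomial hlam mu hmu p l, monomial hlam mu hmu q r⟫_ℂ =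
      ((∑ i : Fin (m + 1), gamInvCoeff (2 * lam - m) i l * gamInvCoeff (2 * lam - m) i r /
        mu i ^ 2 * (p.descFactorial ((i : ℕ) - l) * q.descFactorial ((i : ℕ) - r) *
          ((p + l - i).factorial /
            (ascPochhammer ℝ (p + l - i)).eval (2 * lam - m + 2 * (i : ℕ)))) : ℝ) : ℂ) := by
  rw [inner_monomial, Complex.ofReal_sum]
  refine Finset.sum_congr rfl fun i _ => ?_
  have h1 := weight_sq (lamj_pos hlam i) (p + l - i)
  rw [two_mul_lamj] at h1
  have h2 := (hmu i).ne'
  have h3 := (weight_pos (lamj_pos hlam i) (p + l - i)).ne'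
  have h4 : ((p + l - i).factorial : ℝ) /
      (ascPochhammer ℝ (p + l - i)).eval (2 * lam - m + 2 * (i : ℕ)) =
      (weight (lamj m lam i) (p + l - i) ^ 2)⁻¹ := by
    rw [h1, inv_div]
  rw [h4, if_pos (by rw [h]), mul_one, ← Complex.ofReal_mul, monomialCoeff,
    monomialCoeff, ← h]
  congr 1
  field_simp

/-- The limit of the rescaled inner products of `zᵖ⁺ⁿ e_l` and `z^{q+n} e_r`. -/
def gramLimit (lam : ℝ) (mu : Fin (m + 1) → ℝ) (l r : Fin (m + 1)) : ℝ :=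
  ∑ i : Fin (m + 1), gamInvCoeff (2 * lam - m) i l * gamInvCoeff (2 * lam - m) i r / mu i ^ 2 *
    Real.Gamma (2 * lam - m + 2 * (i : ℕ))

/-- The terms with i ≥ max(l, r) all have the sign (-1)^{l+r}, and the others vanish. -/
theorem gramLimit_ne_zero (hlam : (m : ℝ) / 2 < lam) (hmu : ∀ j, 0 < mu j)
    (l r : Fin (m + 1)) : gramLimit lam mu l r ≠ 0 := by
  have hx : 0 < 2 * lam - m := by linarith
  have hpos : ∀ i : Fin (m + 1), l ≤ i → r ≤ i → 0 < (-1) ^ ((l : ℕ) + r) *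
      (gamInvCoeff (2 * lam - m) i l * gamInvCoeff (2 * lam - m) i r / mu i ^ 2 *
        Real.Gamma (2 * lam - m + 2 * (i : ℕ))) := by
    intro i hli hri
    have h1 := neg_one_pow_mul_gamInvCoeff_pos hx (Fin.le_def.1 hli)
    have h2 := neg_one_pow_mul_gamInvCoeff_pos hx (Fin.le_def.1 hri)
    have h3 := Real.Gamma_pos_of_pos (by positivity : 0 < 2 * lam - m + 2 * (i : ℕ))
    have h4 := hmu i
    have h5 : (-1 : ℝ) ^ ((l : ℕ) + r) = (-1) ^ ((i : ℕ) - l) * (-1) ^ ((i : ℕ) - r) := by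
      rw [← pow_add]
      refine neg_one_pow_congr ?_
      rw [Nat.even_iff, Nat.even_iff]
      omega
    rw [h5]
    calc 0 < ((-1) ^ ((i : ℕ) - l) * gamInvCoeff (2 * lam - m) i l) *
          ((-1) ^ ((i : ℕ) - r) * gamInvCoeff (2 * lam - m) i r) / mu i ^ 2 *
            Real.Gamma (2 * lam - m + 2 * (i : ℕ)) := by positivity
      _ = _ := by ring
  have : 0 < (-1) ^ ((l : ℕ) + r) * gramLimit lam mu l r := by
    rw [gramLimit, Finset.mul_sum]
    refine Finset.sum_pos' (fun i _ => ?_)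
      ⟨max l r, Finset.mem_univ _, hpos _ (le_max_left _ _) (le_max_right _ _)⟩
    rcases lt_or_ge i l with hli | hli
    · simp [gamInvCoeff_of_lt _ (Fin.lt_def.1 hli)]
    rcases lt_or_ge i r with hri | hri
    · simp [gamInvCoeff_of_lt _ (Fin.lt_def.1 hri)]
    exact (hpos i hli hri).le
  exact right_ne_zero_of_mul this.ne'

/-- In the i-th term the falling factorials grow like n^{2i-l-r} and the factorial quotient decays
like n^{1-x-2i}, where x = 2λ - m. The index i cancels, so all terms have the same order
n^{1-x-l-r}. -/
theorem tendsto_inner_monomial {p q : ℕ} {l r : Fin (m + 1)} (h : p + l = q + r) :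
    Tendsto (fun n : ℕ => (((n : ℝ) ^ (2 * lam - m - 1 + (l : ℕ) + (r : ℕ)) : ℝ) : ℂ) *
        ⟪monomial hlam mu hmu (p + n) l, monomial hlam mu hmu (q + n) r⟫_ℂ)
      atTop (𝓝 (gramLimit lam mu l r : ℂ)) := by
  have hx : 0 < 2 * lam - m := by linarith
  simp_rw [fun n : ℕ => inner_monomial_of_eq (hlam := hlam) (mu := mu) (hmu := hmu)
    (by omega : p + n + l = q + n + r), ← Complex.ofReal_mul]
  refine (Complex.continuous_ofReal.tendsto _).comp ?_
  simp_rw [Finset.mul_sum]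
  refine tendsto_finsetSum _ fun i _ => ?_
  rcases lt_or_ge i l with hli | hli
  · simp [gamInvCoeff_of_lt _ (Fin.lt_def.1 hli)]
  rcases lt_or_ge i r with hri | hri
  · simp [gamInvCoeff_of_lt _ (Fin.lt_def.1 hri)]
  have h1 := (((tendsto_descFactorial_div_pow p ((i : ℕ) - l)).mul
    (tendsto_descFactorial_div_pow q ((i : ℕ) - r))).mul
    (tendsto_factorial_div_ascPochhammer_shift
      (by positivity : 0 < 2 * lam - m + 2 * (i : ℕ)) (p + l) i)).const_mul
    (gamInvCoeff (2 * lam - m) i l * gamInvCoeff (2 * lam - m) i r / mu i ^ 2)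
  rw [one_mul, one_mul] at h1
  refine h1.congr' ?_
  filter_upwards [eventually_gt_atTop 0] with n hn
  have hn' : (0 : ℝ) < n := by positivity
  have h2 : (n : ℝ) ^ (2 * lam - m + 2 * (i : ℕ) - 1) =
      (n : ℝ) ^ (2 * lam - m - 1 + (l : ℕ) + (r : ℕ)) *
        ((n : ℝ) ^ ((i : ℕ) - l) * (n : ℝ) ^ ((i : ℕ) - r)) := by
    rw [← pow_add, ← Real.rpow_natCast, ← Real.rpow_add hn', Nat.cast_add,
      Nat.cast_sub hli, Nat.cast_sub hri]
    congr 1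
    ring
  rw [h2, show p + n + l = p + l + n by ring]
  field_simp

end ASpace

/-! ### Reducing subspaces and the kernel of the adjoint -/

theorem IsReducing.pow_mem {H : Type*} [NormedAddCommGroup H] [InnerProductSpace ℂ H]
    {T : H →L[ℂ] H} {N : Submodule ℂ H} (hN : IsReducing T N) {f : H}
    (hf : f ∈ N) (k : ℕ) : (T ^ k) f ∈ N := by
  induction k with
  | zero => simpa
  | succ k ih =>
    rw [pow_succ']
    exact hN.2.1 _ ih

section Reducing

variable {H : Type*} [NormedAddCommGroup H] [InnerProductSpace ℂ H] [CompleteSpace H]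
  {T : H →L[ℂ] H} {N : Submodule ℂ H}

theorem IsReducing.orthogonal (hN : IsReducing T N) : IsReducing T Nᗮ := by
  refine ⟨N.isClosed_orthogonal, hN.2.2, ?_⟩
  rw [Submodule.orthogonal_orthogonal_eq_closure, hN.1.submodule_topologicalClosure_eq]
  exact hN.2.1

theorem IsReducing.adjoint_mem_orthogonal (hN : IsReducing T N) {f : H} (hf : f ∈ Nᗮ) :
    T.adjoint f ∈ Nᗮ := by
  rw [Submodule.mem_orthogonal] at hf ⊢
  intro g hg
  rw [ContinuousLinearMap.adjoint_inner_right]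
  exact hf _ (hN.2.1 g hg)

theorem IsReducing.adjoint_mem (hN : IsReducing T N) {f : H} (hf : f ∈ N) :
    T.adjoint f ∈ N := by
  have h : Nᗮᗮ = N := by
    rw [Submodule.orthogonal_orthogonal_eq_closure, hN.1.submodule_topologicalClosure_eq]
  rw [← h] at hf ⊢
  exact hN.orthogonal.adjoint_mem_orthogonal hf

theorem IsReducing.adjoint_pow_mem (hN : IsReducing T N) {f : H} (hf : f ∈ N) (k : ℕ) :
    (T.adjoint ^ k) f ∈ N := by
  induction k with
  | zero => simpa
  | succ k ih =>
    rw [pow_succ']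
    exact hN.adjoint_mem ih

/-- If a total set of vectors is annihilated by powers of `T*`, then every nonzero reducing
subspace of `T` meets the kernel of `T*`. -/
theorem IsReducing.eq_bot_of_ker_adjoint (hN : IsReducing T N)
    (hker : ∀ f ∈ N, T.adjoint f = 0 → f = 0) {S : Set H}
    (hS : ∀ f, (∀ s ∈ S, ⟪s, f⟫_ℂ = 0) → f = 0)
    (hnil : ∀ s ∈ S, ∃ k : ℕ, (T.adjoint ^ k) s = 0) : N = ⊥ := by
  have hpow : ∀ (k : ℕ) (f : H), f ∈ N → (T.adjoint ^ k) f = 0 → f = 0 := by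
    intro k
    induction k with
    | zero => intro f _ h; simpa using h
    | succ k ih =>
      intro f hf h
      rw [pow_succ] at h
      exact hker f hf (ih _ (hN.adjoint_mem hf) h)
  have : CompleteSpace N := hN.1.completeSpace_coe
  refine (Submodule.eq_bot_iff N).2 fun f hf => hS f fun s hs => ?_
  obtain ⟨k, hk⟩ := hnil s hs
  obtain ⟨a, ha, b, hb, rfl⟩ := N.exists_add_mem_mem_orthogonal s
  -- The image of a is minus the image of b, so it lies in both N and its complement and is zero.
  -- Hence a = 0 and s is orthogonal to N.
  have h1 : (T.adjoint ^ k) a ∈ Nᗮ := by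
    rw [map_add, add_eq_zero_iff_eq_neg] at hk
    rw [hk]
    exact Nᗮ.neg_mem (hN.orthogonal.adjoint_pow_mem hb k)
  have h2 : (T.adjoint ^ k) a = 0 :=
    inner_self_eq_zero.1 ((N.mem_orthogonal _).1 h1 _ (hN.adjoint_pow_mem ha k))
  rw [hpow k a ha h2, zero_add]
  exact (N.mem_orthogonal' b).1 hb f hf

end Reducing

/-! ### Irreducibility -/

namespace ASpace

variable {m : ℕ} {lam : ℝ} {mu : Fin (m + 1) → ℝ} {hlam : (m : ℝ) / 2 < lam}
  {hmu : ∀ j, 0 < mu j} {M : ASpace m lam mu hlam hmu →L[ℂ] ASpace m lam mu hlam hmu}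

theorem map_monomial (hM : ∀ (f : ASpace m lam mu hlam hmu) (z : 𝔻), M f z = (z : ℂ) • f z)
    (p : ℕ) (l : Fin (m + 1)) :
    M (monomial hlam mu hmu p l) = monomial hlam mu hmu (p + 1) l := by
  refine RKHS.ext fun z => ?_
  rw [hM, monomial_apply, monomial_apply, smul_smul, pow_succ']

theorem pow_map_monomial (hM : ∀ (f : ASpace m lam mu hlam hmu) (z : 𝔻), M f z = (z : ℂ) • f z)
    (n p : ℕ) (l : Fin (m + 1)) :
    (M ^ n) (monomial hlam mu hmu p l) = monomial hlam mu hmu (p + n) l := by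
  induction n with
  | zero => simp
  | succ n ih =>
    rw [pow_succ', mul_apply_eq_comp, ih, map_monomial hM, add_assoc]

theorem inner_monomial_eq_zero {f : ASpace m lam mu hlam hmu} {p : ℕ} {l : Fin (m + 1)}
    (hf : ∀ (i : Fin (m + 1)) (q : ℕ), q + i = p + l → ⟪basisVec hlam mu hmu i q, f⟫_ℂ = 0) :
    ⟪monomial hlam mu hmu p l, f⟫_ℂ = 0 := by
  rw [inner_monomial_eq_sum]
  refine Finset.sum_eq_zero fun i _ => ?_
  by_cases hc : monomialCoeff lam mu p l i = 0
  · simp [hc]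
  · have := le_of_monomialCoeff_ne_zero hc
    rw [hf i _ (by omega), mul_zero]

/-- A vector of degree less than `s` is annihilated by the `s`-th power of `M*`. -/
theorem adjoint_pow_eq_zero
    (hM : ∀ (f : ASpace m lam mu hlam hmu) (z : 𝔻), M f z = (z : ℂ) • f z) (s : ℕ)
    (f : ASpace m lam mu hlam hmu)
    (hf : ∀ (j : Fin (m + 1)) (n : ℕ), s ≤ n + j → ⟪basisVec hlam mu hmu j n, f⟫_ℂ = 0) :
    (M.adjoint ^ s) f = 0 := by
  induction s generalizing f with
  | zero => simpa using eq_zero_of_inner_basisVec f fun j n => hf j n (Nat.zero_le _)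
  | succ s ih =>
    rw [pow_succ, mul_apply_eq_comp]
    refine ih _ fun j n hs => ?_
    rw [ContinuousLinearMap.adjoint_inner_right, basisVec_eq_sum, map_sum, sum_inner]
    refine Finset.sum_eq_zero fun l _ => ?_
    rw [map_smul, map_monomial hM, inner_smul_left, inner_monomial_eq_zero, mul_zero]
    exact fun i q hq => hf i q (by omega)

/-- In degree above m every monomial z^p e_l has p > 0, hence is divisible by z. This confines ker
M* to degrees at most m. -/
theorem basisVec_mem_range
    (hM : ∀ (f : ASpace m lam mu hlam hmu) (z : 𝔻), M f z = (z : ℂ) • f z)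
    {j : Fin (m + 1)} {n : ℕ} (h : m < n + j) :
    basisVec hlam mu hmu j n ∈ M.range := by
  rw [basisVec_eq_sum]
  refine Submodule.sum_mem _ fun l _ => Submodule.smul_mem _ _
    ⟨monomial hlam mu hmu (n + j - l - 1) l, ?_⟩
  have : n + j - l - 1 + 1 = n + (j : ℕ) - l := by omega
  rw [← this]
  exact map_monomial hM _ _

theorem mem_span_monomial_of_adjoint_eq_zero
    (hM : ∀ (f : ASpace m lam mu hlam hmu) (z : 𝔻), M f z = (z : ℂ) • f z)
    {f : ASpace m lam mu hlam hmu} (hf : M.adjoint f = 0) :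
    f ∈ Submodule.span ℂ
      (Set.range fun x : ℕ × Fin (m + 1) => monomial hlam mu hmu x.1 x.2) := by
  have h1 : ∀ (j : Fin (m + 1)) (n : ℕ), m < n + j → ⟪basisVec hlam mu hmu j n, f⟫_ℂ = 0 := by
    intro j n h
    obtain ⟨g, hg⟩ := basisVec_mem_range hM h
    rw [← hg]
    change ⟪M g, f⟫_ℂ = 0
    rw [← ContinuousLinearMap.adjoint_inner_right, hf, inner_zero_right]
  have h2 : f = ∑ i : Fin (m + 1), ∑ q ∈ Finset.range (m + 1),
      ⟪basisVec hlam mu hmu i q, f⟫_ℂ • basisVec hlam mu hmu i q := by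
    rw [← sub_eq_zero]
    refine eq_zero_of_inner_basisVec _ fun j n => ?_
    simp only [inner_sub_right, inner_sum, inner_smul_right, inner_basisVec_basisVec, mul_ite,
      mul_one, mul_zero]
    rw [Finset.sum_eq_single j (fun i _ hij => by simp [hij]) (by simp)]
    simp only [if_true, Finset.sum_ite_eq']
    split_ifs with hn
    · rw [sub_self]
    · rw [h1 j n (by rw [Finset.mem_range] at hn; omega), sub_zero]
  rw [h2]
  refine Submodule.sum_mem _ fun i _ => Submodule.sum_mem _ fun q _ => Submodule.smul_mem _ _ ?_
  rw [basisVec_eq_sum]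
  exact Submodule.sum_mem _ fun l _ => Submodule.smul_mem _ _
    (Submodule.subset_span ⟨(q + i - l, l), rfl⟩)

/-- Raising l or r makes the inner product decay faster, so scaling for the smallest pair (a, b)
kills every other pair. -/
theorem tendsto_rpow_mul_inner_monomial {p q : ℕ} {l r a b : Fin (m + 1)} (h : p + l = q + r)
    (hal : a ≤ l) (hbr : b ≤ r) :
    Tendsto (fun n : ℕ => (((n : ℝ) ^ (2 * lam - m - 1 + (a : ℕ) + (b : ℕ)) : ℝ) : ℂ) *
        ⟪monomial hlam mu hmu (p + n) l, monomial hlam mu hmu (q + n) r⟫_ℂ)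
      atTop (𝓝 (if l = a ∧ r = b then (gramLimit lam mu a b : ℂ) else 0)) := by
  have h1 := tendsto_inner_monomial (hlam := hlam) (mu := mu) (hmu := hmu) h
  split_ifs with hab
  · obtain ⟨rfl, rfl⟩ := hab
    exact h1
  · have hd : ((l : ℕ) - a) + ((r : ℕ) - b) ≠ 0 := by
      intro h0
      exact hab ⟨Fin.ext (by omega), Fin.ext (by omega)⟩
    have h2 : Tendsto (fun n : ℕ => ((((n : ℝ) ^ (((l : ℕ) - a) + ((r : ℕ) - b)))⁻¹ : ℝ) : ℂ))
        atTop (𝓝 ((0 : ℝ) : ℂ)) :=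
      (Complex.continuous_ofReal.tendsto _).comp (tendsto_inv_atTop_zero.comp
        ((tendsto_pow_atTop hd).comp tendsto_natCast_atTop_atTop))
    have h3 := h2.mul h1
    rw [Complex.ofReal_zero, zero_mul] at h3
    refine h3.congr' ?_
    filter_upwards [eventually_gt_atTop 0] with n hn
    have hn' : (0 : ℝ) < n := by positivity
    have h4 : (n : ℝ) ^ (2 * lam - m - 1 + (l : ℕ) + (r : ℕ)) =
        (n : ℝ) ^ (2 * lam - m - 1 + (a : ℕ) + (b : ℕ)) *
          (n : ℝ) ^ (((l : ℕ) - a) + ((r : ℕ) - b)) := by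
      rw [← Real.rpow_natCast, ← Real.rpow_add hn', Nat.cast_add, Nat.cast_sub hal,
        Nat.cast_sub hbr]
      congr 1
      ring
    rw [h4, ← mul_assoc, ← Complex.ofReal_mul]
    congr 2
    field_simp

/-- Two nonzero polynomials generate invariant subspaces of `M` that are not orthogonal. -/
theorem exists_inner_pow_ne_zero
    (hM : ∀ (f : ASpace m lam mu hlam hmu) (z : 𝔻), M f z = (z : ℂ) • f z)
    {c d : ℕ × Fin (m + 1) →₀ ℂ} (hc : c ≠ 0) (hd : d ≠ 0) :
    ∃ k n : ℕ, ⟪(M ^ k) (c.sum fun x a => a • monomial hlam mu hmu x.1 x.2),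
      (M ^ n) (d.sum fun x a => a • monomial hlam mu hmu x.1 x.2)⟫_ℂ ≠ 0 := by
  -- Leading terms: least l in both polynomials, with ties broken oppositely (largest exponent in c,
  -- smallest in d). Then equality of degrees among terms with the least l forces x = x₀ and y = y₀.
  obtain ⟨x₀, hx₀, hxmin⟩ := Finset.exists_min_image c.support
    (fun x => toLex (x.2, OrderDual.toDual x.1)) (Finsupp.support_nonempty_iff.2 hc)
  obtain ⟨y₀, hy₀, hymin⟩ := Finset.exists_min_image d.support
    (fun x => toLex (x.2, x.1)) (Finsupp.support_nonempty_iff.2 hd)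
  simp only [Prod.Lex.toLex_le_toLex, OrderDual.toDual_le_toDual] at hxmin hymin
  by_contra! hzero
  -- Shifting each polynomial by the degree of the other's leading term puts both leading terms in
  -- the same degree.
  have key : ∀ x ∈ c.support, ∀ y ∈ d.support, Tendsto (fun n : ℕ =>
      conj (c x) * d y *
        ((((n : ℝ) ^ (2 * lam - m - 1 + (x₀.2 : ℕ) + (y₀.2 : ℕ)) : ℝ) : ℂ) *
        ⟪monomial hlam mu hmu (x.1 + (y₀.1 + y₀.2 + n)) x.2,
          monomial hlam mu hmu (y.1 + (x₀.1 + x₀.2 + n)) y.2⟫_ℂ)) atTop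
      (𝓝 (if x = x₀ then if y = y₀ then
        conj (c x₀) * d y₀ * (gramLimit lam mu x₀.2 y₀.2 : ℂ) else 0 else 0)) := by
    intro x hx y hy
    have hx' := hxmin x hx
    have hy' := hymin y hy
    by_cases hdeg : x.1 + (y₀.1 + y₀.2) + x.2 = y.1 + (x₀.1 + x₀.2) + y.2
    · have h1 := (tendsto_rpow_mul_inner_monomial (hlam := hlam) (mu := mu) (hmu := hmu) hdeg
        (a := x₀.2) (b := y₀.2) (by rcases hx' with h | h <;> omega)
        (by rcases hy' with h | h <;> omega)).const_mul (conj (c x) * d y)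
      simp only [add_assoc] at h1 ⊢
      convert h1 using 2
      by_cases hab : x.2 = x₀.2 ∧ y.2 = y₀.2
      · have e1 : x.1 ≤ x₀.1 := by
          rcases hx' with h | h
          · exact absurd hab.1 h.ne'
          · exact h.2
        have e2 : y₀.1 ≤ y.1 := by
          rcases hy' with h | h
          · exact absurd hab.2 h.ne'
          · exact h.2
        obtain ⟨h2, h3⟩ := hab
        rw [h2, h3] at hdeg
        obtain rfl : x = x₀ := Prod.ext (by omega) h2
        obtain rfl : y = y₀ := Prod.ext (by omega) h3
        simp
      · rw [if_neg hab, mul_zero]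
        split_ifs with h2 h3
        · exact absurd ⟨by rw [h2], by rw [h3]⟩ hab
        · rfl
        · rfl
    · have h1 : ¬ (x = x₀ ∧ y = y₀) := by
        rintro ⟨rfl, rfl⟩
        exact hdeg (by ring)
      rw [← ite_and, if_neg h1]
      refine tendsto_const_nhds.congr fun n => ?_
      rw [inner_monomial_of_ne (by omega), mul_zero, mul_zero]
  have h1 := tendsto_finsetSum c.support fun x hx =>
    tendsto_finsetSum d.support fun y hy => key x hx y hy
  have h2 : ∀ n : ℕ, ∑ x ∈ c.support, ∑ y ∈ d.support, conj (c x) * d y *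
        ((((n : ℝ) ^ (2 * lam - m - 1 + (x₀.2 : ℕ) + (y₀.2 : ℕ)) : ℝ) : ℂ) *
        ⟪monomial hlam mu hmu (x.1 + (y₀.1 + y₀.2 + n)) x.2,
          monomial hlam mu hmu (y.1 + (x₀.1 + x₀.2 + n)) y.2⟫_ℂ) = 0 := by
    intro n
    have h3 := hzero (y₀.1 + y₀.2 + n) (x₀.1 + x₀.2 + n)
    simp only [Finsupp.sum, map_sum, map_smul, pow_map_monomial hM, sum_inner, inner_sum,
      inner_smul_left, inner_smul_right] at h3
    rw [← mul_zero ((((n : ℝ) ^ (2 * lam - m - 1 + (x₀.2 : ℕ) + (y₀.2 : ℕ)) : ℝ) : ℂ)), ← h3,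
      Finset.mul_sum, Finset.sum_comm]
    refine Finset.sum_congr rfl fun y _ => ?_
    rw [Finset.mul_sum, Finset.mul_sum]
    refine Finset.sum_congr rfl fun x _ => ?_
    ring
  have h4 := tendsto_nhds_unique (h1.congr h2) tendsto_const_nhds
  rw [Finset.sum_eq_single_of_mem x₀ hx₀ fun x _ hx => Finset.sum_eq_zero fun y _ => if_neg hx,
    Finset.sum_eq_single_of_mem y₀ hy₀ fun y _ hy => by rw [if_pos rfl, if_neg hy],
    if_pos rfl, if_pos rfl] at h4
  refine mul_ne_zero (mul_ne_zero ?_ (Finsupp.mem_support_iff.1 hy₀)) ?_ h4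
  · simpa using Finsupp.mem_support_iff.1 hx₀
  · exact_mod_cast gramLimit_ne_zero hlam hmu _ _

theorem isIrreducibleOp
    (hM : ∀ (f : ASpace m lam mu hlam hmu) (z : 𝔻), M f z = (z : ℂ) • f z) :
    IsIrreducibleOp M := by
  refine ⟨⟨basisVec hlam mu hmu 0 0, 0, fun h => ?_⟩, fun N hN => ?_⟩
  · have := inner_basisVec_basisVec (hlam := hlam) (mu := mu) (hmu := hmu) 0 0 0 0
    rw [h] at this
    simp at this
  have hred : ∀ K : Submodule ℂ (ASpace m lam mu hlam hmu), IsReducing M K →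
      (∀ f ∈ K, M.adjoint f = 0 → f = 0) → K = ⊥ := by
    intro K hK hker
    refine hK.eq_bot_of_ker_adjoint hker
      (S := Set.range fun x : Fin (m + 1) × ℕ => basisVec hlam mu hmu x.1 x.2)
      (fun f hf => eq_zero_of_inner_basisVec f fun j n => hf _ ⟨(j, n), rfl⟩) ?_
    rintro _ ⟨⟨i, q⟩, rfl⟩
    -- The vector has degree q + i, so one more power is needed to annihilate it.
    refine ⟨q + i + 1, adjoint_pow_eq_zero hM _ _ fun j n hjn => ?_⟩
    rw [inner_basisVec_basisVec]
    split_ifs with h1 h2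
    · subst h1 h2
      simp at hjn
    · rfl
    · rfl
  by_contra! hne
  obtain ⟨f, hf, hf0, hfne⟩ : ∃ f ∈ N, M.adjoint f = 0 ∧ f ≠ 0 := by
    by_contra! h
    exact hne.1 (hred N hN h)
  obtain ⟨g, hg, hg0, hgne⟩ : ∃ g ∈ Nᗮ, M.adjoint g = 0 ∧ g ≠ 0 := by
    by_contra! h
    have h1 := hred Nᗮ hN.orthogonal h
    have : CompleteSpace N := hN.1.completeSpace_coe
    exact hne.2 ((Submodule.orthogonal_eq_bot_iff).1 h1)
  obtain ⟨c, rfl⟩ := Finsupp.mem_span_range_iff_exists_finsupp.1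
    (mem_span_monomial_of_adjoint_eq_zero hM hf0)
  obtain ⟨d, rfl⟩ := Finsupp.mem_span_range_iff_exists_finsupp.1
    (mem_span_monomial_of_adjoint_eq_zero hM hg0)
  obtain ⟨k, n, hkn⟩ := exists_inner_pow_ne_zero hM (c := c) (d := d)
    (by rintro rfl; simp at hfne) (by rintro rfl; simp at hgne)
  exact hkn ((N.mem_orthogonal _).1 (hN.orthogonal.pow_mem hg n) _ (hN.pow_mem hf k))

end ASpace

end KoranyiMisra

end

theorem mainTheorem1 (m : ℕ) (lam : ℝ) (hlam : (m : ℝ) / 2 < lam)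
    (mu : Fin (m + 1) → ℝ) (hmu : ∀ j, 0 < mu j) (hmu0 : mu 0 = 1) :
    ∃ M : KoranyiMisra.ASpace m lam mu hlam hmu →L[ℂ] KoranyiMisra.ASpace m lam mu hlam hmu,
      (∀ (f : KoranyiMisra.ASpace m lam mu hlam hmu) (z : Complex.UnitDisc),
        M f z = (z : ℂ) • f z) ∧
      KoranyiMisra.IsIrreducibleOp M := by
  obtain ⟨M, hM⟩ := KoranyiMisra.ASpace.exists_mulCLM (hlam := hlam) (mu := mu) (hmu := hmu)
  exact ⟨M, hM, KoranyiMisra.ASpace.isIrreducibleOp hM⟩
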